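/- Conventions. A graph $\Gamma=(N,E)$ (finite or infinite) may have multiple edges; each edge is a link (two distinct endpoints) or a half edge (one endpoint). A circle is the edge set of a simple closed path (of length at least 2). A biased graph $\Omega=(\Gamma,\mathcal B)$ is a graph with a class $\mathcal B$ of circles, called balanced, such that no theta graph contains exactly two balanced circles. Its frame matroid $G(\Omega)$ is the finitary matroid on $E$ whose circuits are: the balanced circles; the theta graphs that contain no balanced circle; the unions of two distinct unbalanced figures (half edges or unbalanced circles) that meet in exactly one node; and the unions of two node-disjoint unbalanced figures and a path that joins them and meets each of them only at one of its endpoints. An $F^\times$-gain graph $\Phi=(\Gamma,\phi)$ has gains $\phi(e_{vw})\in F^\times$ on its links, with $\phi(e_{wv})=\phi(e_{vw})^{-1}$; its biased graph $\langle\Phi\rangle$ has as balanced circles those whose gain product, taken in order around the circle, is $1$, and $G(\Phi)=G(\langle\Phi\rangle)$. Let $F$ be a division ring, let $V$ be a left $F$-vector space with projective geometry $\mathbb P(F)=\mathbb P(V)$, and let $\hat N=\{\hat v: v\in N\}$ be a point basis of $\mathbb P(F)$ indexed by $N$. For $v\in N$ the node hyperplane is $\hat v^*=\operatorname{span}(\hat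 N\setminus\{\hat v\})$. For $p\notin\hat N$ on a line $\hat v\hat w$ ($v\ne w$) let $h(p)=\operatorname{span}\big((\hat N\setminus\{\hat v,\hat w\})\cup\{p\}\big)$. A Cevian arrangement with respect to $\hat N$ is a set $\mathcal A$ of hyperplanes, each of the form $\hat v^*$ or $h(p)$. Its matroid $M(\mathcal A)$ is the finitary matroid in which a finite set of hyperplanes has as rank the codimension of its intersection. The biased graph $\Omega(\mathcal A)$ has node set $N\leftrightarrow\hat N\leftrightarrow\hat N^*=\{\hat v^*:v\in N\}$ and edge set $\mathcal A$, where $\hat v^*$ is a half edge at $v$, $h(p)$ with $p\in\hat v\hat w\setminus\hat N$ is a link with endpoints $v,w$, and a circle is balanced if its rank in $M(\mathcal A)$ is less than its size. Arrangements may also be taken as families $(h(e))_{e\in E}$, with the corresponding meaning of $\Omega$ and $M$ (equal hyperplanes being parallel elements). A synthetic Cevian representation of $G(\Omega)$ with respect to $\hat N$ is a Cevian arrangement, indexed by $E$ through $e\mapsto h(e)$, such that $h(e)$ is a node hyperplane $\hat v^*$ if $e$ is a half edge at $v$, is $h(p)$ for some $p\in\hat v\hat w\setminus\hat N$ if $e$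 is a link with endpoints $v,w$, and such that $e\mapsto h(e)$ identifies $G(\Omega)$ with the matroid of the arrangement. If $b=(b_v)_{v\in N}$ is a basis of $V$, put $\hat v=[b_v]$. The analytic Cevian arrangement $\mathcal C[\Phi]$ of an $F^\times$-gain graph $\Phi$ on $N$ consists of the hyperplanes $h(e)=\hat v^*$ for a half edge $e$ at $v$, and $h(e)=h(\bar e)$ with apex $\bar e=[\,b_v+\phi(e_{vw})\,b_w\,]$ for a link $e=e_{vw}$; that is, $h(e)$ is given by $x_w=x_v\,\phi(e_{vw})$ in the coordinates of $b$. Theorem. (1) For every gain graph $\Phi$ with gains in $F^\times$ and every basis $b$ of $V$ indexed by $N$, $\mathcal C[\Phi]$, as a family indexed by $E$, is a synthetic Cevian representation of $G(\Phi)$; $\langle\Phi\rangle$ is a biased graph and is the biased graph of the family $\mathcal C[\Phi]$. The map $v\mapsto\hat v^*$ is injective. The map $e\mapsto h(e)$ is injective if and only if $G(\Phi)$ is simple, that is, $\Phi$ has no balanced digon and no two half edges at the same node. If $G(\Phi)$ is simple, then $v\mapsto\hat v^*$ and $e\mapsto h(e)$ are isomorphisms $\langle\Phi\rangle\cong\Omega(\mathcal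 C[\Phi])$ and $G(\Phi)\cong M(\mathcal C[\Phi])$. (2) Conversely, let $\Omega$ be any biased graph (for instance the full biased graph $\Omega^\bullet$ obtained from a biased graph by adjoining a half edge at every node that has none, so that $G(\Omega^\bullet)$ is the full frame matroid), and let $(h(e))_{e\in E}$ be a synthetic Cevian representation of $G(\Omega)$ in $\mathbb P(F)$ with respect to a point basis $\hat N$. Then there is a vector basis $b$ with $\hat v=[b_v]$ for all $v\in N$, and for each such basis there is a gain graph $\Phi$ with gains in $F^\times$ such that $\langle\Phi\rangle=\Omega$ and $(h(e))_{e\in E}$ is the analytic Cevian arrangement $\mathcal C[\Phi]$ in the coordinates of $b$. -/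

import Mathlib

open scoped LinearAlgebra.Projectivization

noncomputable section

namespace Cevian

/-! ### Graphs with links and half edges, biased graphs, frame circuits -/

/-- The data of a graph with node set `N` and edge set `E`: the set of endpoints of each edge.
Parallel edges are allowed, and both sets may be infinite. -/
structure Multigraph (N E : Type*) where
  ends : E → Set N

namespace Multigraph

variable {N E : Type*} (Γ : Multigraph N E)

/-- `e` is a half edge, with `v` as its only endpoint. -/
def IsHalfEdge (e : E) (v : N) : Prop := Γ.ends e = {v}

/-- `e` is a link with the two distinct endpoints `v` and `w`. -/
def IsLink (e : E) (v w : N) : Prop := v ≠ w ∧ Γ.ends e = {v, w}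

/-- Every edge is a half edge or a link (there are no loops and no loose edges). -/
def IsGraph : Prop := ∀ e, (∃ v, Γ.IsHalfEdge e v) ∨ ∃ v w, Γ.IsLink e v w

/-- The nodes of the edges in `S`. -/
def nodes (S : Set E) : Set N := ⋃ e ∈ S, Γ.ends e

/-- `c 0, …, c (n + 1)` are the edges of a simple closed path of length `n + 2 ≥ 2`
that visits the nodes `u 0, …, u (n + 1)` in this order (indices are cyclic). -/
def IsClosedPath {n : ℕ} (u : Fin (n + 2) → N) (c : Fin (n + 2) → E) : Prop :=
  u.Injective ∧ c.Injective ∧ ∀ i, Γ.IsLink (c i) (u i) (u (i + 1))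

/-- A circle is the edge set of a simple closed path. -/
def IsCircle (C : Set E) : Prop :=
  ∃ (n : ℕ) (u : Fin (n + 2) → N) (c : Fin (n + 2) → E),
    Γ.IsClosedPath u c ∧ C = Set.range c

/-- `P` is the edge set of a simple path of length at least `1` from `x` to `y`. -/
def IsPath (x y : N) (P : Set E) : Prop :=
  ∃ (n : ℕ) (u : Fin (n + 2) → N) (c : Fin (n + 1) → E),
    u.Injective ∧ u 0 = x ∧ u (Fin.last (n + 1)) = y ∧
      (∀ i, Γ.IsLink (c i) (u i.castSucc) (u i.succ)) ∧ P = Set.range c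

/-- `P`, `Q`, `R` are three internally disjoint paths with the same two endpoints;
their union is a theta graph, whose circles are `P ∪ Q`, `Q ∪ R` and `P ∪ R`. -/
def IsTheta (P Q R : Set E) : Prop :=
  ∃ x y, x ≠ y ∧ Γ.IsPath x y P ∧ Γ.IsPath x y Q ∧ Γ.IsPath x y R ∧
    Disjoint P Q ∧ Disjoint Q R ∧ Disjoint P R ∧
    Γ.nodes P ∩ Γ.nodes Q = {x, y} ∧ Γ.nodes Q ∩ Γ.nodes R = {x, y} ∧
    Γ.nodes P ∩ Γ.nodes R = {x, y}

end Multigraph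

/-- A graph together with a class `balanced` of edge sets. It is a biased graph if it satisfies
`BiasedGraph.IsBiased`. -/
structure BiasedGraph (N E : Type*) extends Multigraph N E where
  balanced : Set (Set E)

namespace BiasedGraph

variable {N E : Type*} (Ω : BiasedGraph N E)

/-- The axioms of a biased graph: `balanced` is a class of circles, and no theta graph contains
exactly two circles of that class. -/
structure IsBiased : Prop where
  isGraph : Ω.IsGraph
  isCircle : ∀ C ∈ Ω.balanced, Ω.IsCircle C
  /-- The three paths of a theta graph may be listed in any order, so this excludes exactly two
  balanced circles whichever two they are. -/
  linear : ∀ P Q R, Ω.IsTheta P Q R →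
    P ∪ Q ∈ Ω.balanced → Q ∪ R ∈ Ω.balanced → P ∪ R ∈ Ω.balanced

/-- An unbalanced figure is a half edge or an unbalanced circle. -/
def IsUnbalancedFigure (U : Set E) : Prop :=
  (∃ e v, Ω.IsHalfEdge e v ∧ U = {e}) ∨ (Ω.IsCircle U ∧ U ∉ Ω.balanced)

/-- A frame circuit is a balanced circle, a theta graph without balanced circle, two unbalanced
figures that meet in a single node, or two unbalanced figures without common node together with
a path that joins them and meets each figure at one of its endpoints only. -/
def IsFrameCircuit (S : Set E) : Prop :=
  S ∈ Ω.balanced ∨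
  (∃ P Q R, Ω.IsTheta P Q R ∧ P ∪ Q ∉ Ω.balanced ∧ Q ∪ R ∉ Ω.balanced ∧
    P ∪ R ∉ Ω.balanced ∧ S = P ∪ Q ∪ R) ∨
  (∃ U₁ U₂, Ω.IsUnbalancedFigure U₁ ∧ Ω.IsUnbalancedFigure U₂ ∧ U₁ ≠ U₂ ∧
    (∃ v, Ω.nodes U₁ ∩ Ω.nodes U₂ = {v}) ∧ S = U₁ ∪ U₂) ∨
  (∃ U₁ U₂ P x y, Ω.IsUnbalancedFigure U₁ ∧ Ω.IsUnbalancedFigure U₂ ∧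
    Disjoint (Ω.nodes U₁) (Ω.nodes U₂) ∧ Ω.IsPath x y P ∧
    Ω.nodes U₁ ∩ Ω.nodes P = {x} ∧ Ω.nodes U₂ ∩ Ω.nodes P = {y} ∧ S = U₁ ∪ U₂ ∪ P)

/-- `M` is the frame matroid `G(Ω)`: the matroid on the edge set of `Ω` whose circuits are the
frame circuits. (A matroid is determined by its ground set and its circuits.) -/
def IsFrameMatroid (M : Matroid E) : Prop :=
  M.E = Set.univ ∧ ∀ S, M.IsCircuit S ↔ Ω.IsFrameCircuit S

/-- The maps `f` on nodes and `g` on edges form an isomorphism of biased graphs: an isomorphism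
of the underlying graphs that preserves balance and imbalance of circles. -/
structure IsIso {N' E' : Type*} (Ω' : BiasedGraph N' E') (f : N → N') (g : E → E') : Prop where
  node_bijective : f.Bijective
  edge_bijective : g.Bijective
  ends : ∀ e, Ω'.ends (g e) = f '' Ω.ends e
  balanced : ∀ C, Ω.IsCircle C → (g '' C ∈ Ω'.balanced ↔ C ∈ Ω.balanced)

end BiasedGraph

/-! ### Gain graphs -/

/-- A gain graph with gain group `G`: `gain e v w` is the gain of the link `e` in the direction
from `v` to `w`. (Its value is irrelevant when `e` is not a link with endpoints `v` and `w`; in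
particular half edges have no gain.) -/
structure GainGraph (N E G : Type*) [Group G] extends Multigraph N E where
  isGraph : toMultigraph.IsGraph
  gain : E → N → N → G
  gain_inv : ∀ e v w, toMultigraph.IsLink e v w → gain e w v = (gain e v w)⁻¹

namespace GainGraph

variable {N E G : Type*} [Group G] (Φ : GainGraph N E G)

/-- The biased graph of a gain graph: a circle is balanced if the product of the gains of its
edges, in the order and direction in which a simple closed path traverses it, is `1`. -/
def biasedGraph : BiasedGraph N E where
  toMultigraph := Φ.toMultigraph
  balanced := {C | ∃ (n : ℕ) (u : Fin (n + 2) → N) (c : Fin (n + 2) → E),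
    Φ.IsClosedPath u c ∧ C = Set.range c ∧
      (List.ofFn fun i => Φ.gain (c i) (u i) (u (i + 1))).prod = 1}

/-- Simplicity of the frame matroid of `Φ`: there are no two half edges at the same node and no
balanced digons (that is, parallel links have different gains). -/
def IsSimple : Prop :=
  (∀ e f v, Φ.IsHalfEdge e v → Φ.IsHalfEdge f v → e = f) ∧
  (∀ e f v w, Φ.IsLink e v w → Φ.IsLink f v w → Φ.gain e v w = Φ.gain f v w → e = f)

end GainGraph

/-! ### The matroid of a set of hyperplanes

A flat of the projective geometry `ℙ F V` is given by the corresponding vector subspace of `V`,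
so that the projective hyperplanes are the coatoms of `Submodule F V`. -/

section Hyperplanes

variable {F V : Type*} [DivisionRing F] [AddCommGroup V] [Module F V]

/-- The codimension of a flat. -/
def codim (T : Submodule F V) : Cardinal := Module.rank F (V ⧸ T)

theorem codim_mono {S T : Submodule F V} (h : S ≤ T) : codim T ≤ codim S :=
  LinearMap.rank_le_of_surjective (Submodule.factor h) (Submodule.factor_surjective h)

theorem codim_inf_of_not_le {T H : Submodule F V} (hH : IsCoatom H) (h : ¬ T ≤ H) :
    codim (H ⊓ T) = codim T + 1 := by
  have hsup : T ⊔ H = ⊤ := by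
    rcases hH.le_iff.1 (le_sup_right : H ≤ T ⊔ H) with h' | h'
    · exact h'
    · exact absurd (h' ▸ le_sup_left) h
  have hsimple : IsSimpleModule F (V ⧸ H) := isSimpleModule_iff_isCoatom.2 hH
  have h1 : Module.rank F (V ⧸ H) = 1 := by
    have := isSimpleModule_iff_finrank_eq_one.1 hsimple
    exact Module.rank_eq_one_iff_finrank_eq_one.2 this
  let f : T →ₗ[F] (V ⧸ (H ⊓ T)) := (H ⊓ T).mkQ.comp T.subtype
  have hker : LinearMap.ker f = LinearMap.ker (H.mkQ.comp T.subtype) := by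
    ext x
    simp [f]
  have hsurj : Function.Surjective (H.mkQ.comp T.subtype) := by
    intro y
    obtain ⟨v, rfl⟩ := H.mkQ_surjective y
    have hv : v ∈ T ⊔ H := hsup ▸ Submodule.mem_top
    obtain ⟨t, ht, k, hk, rfl⟩ := Submodule.mem_sup.1 hv
    refine ⟨⟨t, ht⟩, ?_⟩
    simpa [Submodule.Quotient.eq] using hk
  have hrange : LinearMap.range f = T.map (H ⊓ T).mkQ := by
    simp [f, LinearMap.range_comp]
  have hr : Module.rank F (T.map (H ⊓ T).mkQ) = 1 := by
    rw [← hrange, ← (f.quotKerEquivRange).rank_eq, hker,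
      ((H.mkQ.comp T.subtype).quotKerEquivOfSurjective hsurj).rank_eq, h1]
  have := Submodule.rank_quotient_add_rank (T.map (H ⊓ T).mkQ)
  rw [hr, (Submodule.quotientQuotientEquivQuotient (H ⊓ T) T inf_le_right).rank_eq] at this
  exact this.symm

theorem codim_inf_le {T H : Submodule F V} (hH : IsCoatom H) :
    codim (H ⊓ T) ≤ codim T + 1 := by
  by_cases h : T ≤ H
  · rw [inf_eq_right.2 h]; exact self_le_add_right _ _
  · exact (codim_inf_of_not_le hH h).le

theorem codim_finset_le [DecidableEq (Submodule F V)] (I J : Finset (Submodule F V))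
    (hJ : ∀ H ∈ J, IsCoatom H) : codim ((J ∪ I).inf id) ≤ codim (I.inf id) + J.card := by
  induction J using Finset.induction_on with
  | empty => simp
  | insert H J hHJ ih =>
    rw [Finset.insert_union, Finset.inf_insert, id, Finset.card_insert_of_notMem hHJ]
    refine (codim_inf_le (hJ H (Finset.mem_insert_self _ _))).trans ?_
    push_cast
    rw [← add_assoc]
    gcongr
    exact ih fun K hK => hJ K (Finset.mem_insert_of_mem hK)

theorem codim_top : codim (⊤ : Submodule F V) = 0 := by
  simp [codim]

/-- The matroid `M(𝒜)` of a set `𝒜` of hyperplanes: the finitary matroid in which the rank of a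
finite set of hyperplanes is the codimension of its intersection, so that a finite set is
independent if that codimension equals its number of elements. The ground set is `𝒜` (members of
`𝒜` that are not hyperplanes, if any, are discarded). -/
def hyperplaneMatroid (𝒜 : Set (Submodule F V)) : Matroid (Submodule F V) := by
  classical
  exact (IndepMatroid.ofFinset (𝒜 ∩ {H | IsCoatom H})
    (fun I => (I : Set (Submodule F V)) ⊆ 𝒜 ∩ {H | IsCoatom H} ∧ codim (I.inf id) = I.card)
    (by simp [codim_top])
    (by
      rintro I J ⟨hJ, hJc⟩ hIJ
      have hI : (I : Set (Submodule F V)) ⊆ 𝒜 ∩ {H | IsCoatom H} :=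
        (Finset.coe_subset.2 hIJ).trans hJ
      refine ⟨hI, le_antisymm ?_ ?_⟩
      · simpa [codim_top] using codim_finset_le ∅ I fun H hH => (hI hH).2
      · have h := codim_finset_le I (J \ I) fun H hH => (hJ (Finset.mem_sdiff.1 hH).1).2
        rw [Finset.sdiff_union_of_subset hIJ, hJc, ← Finset.card_sdiff_add_card_eq_card hIJ,
          Nat.cast_add, add_comm] at h
        exact (Cardinal.add_le_add_iff_of_lt_aleph0 (Cardinal.natCast_lt_aleph0)).1 h)
    (by
      rintro I J ⟨hI, hIc⟩ ⟨hJ, hJc⟩ hlt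
      by_contra! hcon
      have hle : I.inf id ≤ J.inf id := by
        refine Finset.le_inf fun H hH => ?_
        by_cases hHI : H ∈ I
        · exact Finset.inf_le hHI
        · by_contra hnot
          refine hcon H hH hHI ?_ ?_
          · simp only [Finset.coe_insert]
            exact Set.insert_subset (hJ hH) hI
          · rw [Finset.inf_insert, id, codim_inf_of_not_le (hJ hH).2 hnot, hIc,
              Finset.card_insert_of_notMem hHI]
            simp
      have := codim_mono hle
      rw [hIc, hJc] at this
      exact absurd (Nat.cast_le.1 this) (not_le.2 hlt))
    (fun I hI => hI.1)).matroid

end Hyperplanes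

/-! ### Cevian hyperplanes in a projective geometry -/

section Projective

variable {F V : Type*} [DivisionRing F] [AddCommGroup V] [Module F V] {N E : Type*}

/-- The points `P v` form a basis of the projective geometry `ℙ F V`: they are independent, and
they span it. -/
def IsPointBasis (P : N → ℙ F V) : Prop :=
  Projectivization.Independent P ∧ ⨆ v, (P v).submodule = ⊤

/-- The node hyperplane `v̂*` is the span of all basis points but `v̂ = P v`. -/
def nodeHyperplane (P : N → ℙ F V) (v : N) : Submodule F V :=
  ⨆ u ∈ ({v} : Set N)ᶜ, (P u).submodule

/-- The hyperplane `h(p)` with apex `p` on the edge line of `P v` and `P w`, `p` not a basis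
point: the span of `p` and all basis points but `P v` and `P w`. -/
def apicalHyperplane (P : N → ℙ F V) (v w : N) (p : ℙ F V) : Submodule F V :=
  (⨆ u ∈ ({v, w} : Set N)ᶜ, (P u).submodule) ⊔ p.submodule

/-- `p` is a point of the line through the distinct points `P v` and `P w`, and not a basis
point. -/
def IsApex (P : N → ℙ F V) (v w : N) (p : ℙ F V) : Prop :=
  v ≠ w ∧ p.submodule ≤ (P v).submodule ⊔ (P w).submodule ∧ p ∉ Set.range P

/-- `H` is an apical hyperplane of the basis `P`, node hyperplanes included. -/
def IsApicalHyperplane (P : N → ℙ F V) (H : Submodule F V) : Prop :=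
  (∃ v, H = nodeHyperplane P v) ∨ ∃ v w p, IsApex P v w p ∧ H = apicalHyperplane P v w p

/-- The endpoints of the edge that corresponds to the apical hyperplane `H`: a node hyperplane
`v̂*` gives a half edge at `v`, a hyperplane with apex on the line `v̂ŵ`, off the basis, gives a
link with endpoints `v` and `w`. -/
def apicalEnds (P : N → ℙ F V) (H : Submodule F V) : Set N :=
  {v | H = nodeHyperplane P v ∨ ∃ w p, IsApex P v w p ∧ H = apicalHyperplane P v w p}

/-- The biased graph `Ω(𝒜)` of a Cevian arrangement `𝒜 = {h e : e ∈ E}`, indexed by the edge set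
`E`, with respect to the basis `{P v : v ∈ N}`, indexed by the node set `N`. A circle is balanced
if its rank (the codimension of the intersection of its hyperplanes) is less than its size. -/
def cevianBiasedGraph (P : N → ℙ F V) (h : E → Submodule F V) : BiasedGraph N E where
  ends e := apicalEnds P (h e)
  balanced := {C | (Multigraph.mk fun e => apicalEnds P (h e)).IsCircle C ∧
    codim (⨅ e ∈ C, h e) < (C.ncard : Cardinal)}

/-- `Ω(𝒜)` for a set `𝒜` of hyperplanes and a set `B` of basis points, with `B` (equivalently
the set of node hyperplanes) as node set and `𝒜` as edge set. -/
def cevianBiasedGraphOfSet (B : Set (ℙ F V)) (𝒜 : Set (Submodule F V)) : BiasedGraph B 𝒜 :=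
  cevianBiasedGraph (Subtype.val : B → ℙ F V) (Subtype.val : 𝒜 → Submodule F V)

/-- The maps `v ↦ v̂*` (given through `v ↦ P v`) and `e ↦ h e` are a synthetic Cevian
representation of the frame matroid `G(Ω)`: every `h e` is an apical hyperplane of the basis `P`,
located according to the endpoints of `e`, and `e ↦ h e` identifies `G(Ω)` with the matroid of the
arrangement `{h e : e ∈ E}`. (If `h` is injective, that is an isomorphism of matroids. In
general `h e = h f` means that `e` and `f` are parallel elements of the matroid.) -/
structure IsCevianRepresentation (Ω : BiasedGraph N E) (P : N → ℙ F V)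
    (h : E → Submodule F V) : Prop where
  isPointBasis : IsPointBasis P
  isApical : ∀ e, IsApicalHyperplane P (h e)
  ends : ∀ e, apicalEnds P (h e) = Ω.ends e
  isFrameMatroid : Ω.IsFrameMatroid ((hyperplaneMatroid (Set.range h)).comap h)

/-! ### The analytic Cevian representation of a gain graph -/

/-- The point with homogeneous coordinates `[0, …, 0, 1, 0, …, 0]`, the `1` at `v`, in the
coordinate system given by the vector basis `b`. -/
def basisPoint (b : Module.Basis N F V) (v : N) : ℙ F V :=
  Projectivization.mk F (b v) (b.ne_zero v)

theorem apex_ne_zero (b : Module.Basis N F V) {v w : N} (hvw : v ≠ w) (g : Fˣ) :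
    b v + (g : F) • b w ≠ 0 := by
  intro h
  have := congrArg (fun x => b.repr x v) h
  simp [hvw.symm] at this

/-- The apex `[v̂ + g ŵ]` of a link with gain `g` from `v` to `w`. For `g ≠ -1` it is the point
`(1 + g)⁻¹ (v̂ + g ŵ)` of the affine hyperplane where the sum of the coordinates is `1`; for
`g = -1` it is the point of the line `v̂ŵ` in the ideal hyperplane where that sum is `0`. -/
def apex (b : Module.Basis N F V) {v w : N} (hvw : v ≠ w) (g : Fˣ) : ℙ F V :=
  Projectivization.mk F (b v + (g : F) • b w) (apex_ne_zero b hvw g)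

theorem apex_swap (b : Module.Basis N F V) {v w : N} (hvw : v ≠ w) (g : Fˣ) :
    apex b hvw.symm g⁻¹ = apex b hvw g := by
  rw [apex, apex, Projectivization.mk_eq_mk_iff']
  refine ⟨(g⁻¹ : Fˣ), ?_⟩
  rw [smul_add, smul_smul, Units.inv_mul, one_smul, add_comm]

end Projective

namespace GainGraph

variable {F V : Type*} [DivisionRing F] [AddCommGroup V] [Module F V] {N E : Type*}
  (Φ : GainGraph N E Fˣ) (b : Module.Basis N F V)

theorem exists_isHalfEdge {e : E} (he : ¬ ∃ v w, Φ.IsLink e v w) : ∃ v, Φ.IsHalfEdge e v :=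
  (Φ.isGraph e).resolve_right he

open Classical in
/-- The hyperplane `h(ē)` of the edge `e` in the analytic Cevian representation `𝒞[Φ]`, in the
coordinate system `b`. By the two theorems below, this is the node hyperplane `v̂*` for a half
edge at `v`, and the hyperplane with apex `[v̂ + φ(e) ŵ]` for a link with endpoints `v` and `w`
and gain `φ(e)` from `v` to `w`. -/
def cevianHyperplane (e : E) : Submodule F V :=
  if he : ∃ v w, Φ.IsLink e v w then
    apicalHyperplane (basisPoint b) he.choose he.choose_spec.choose
      (apex b he.choose_spec.choose_spec.1 (Φ.gain e he.choose he.choose_spec.choose))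
  else nodeHyperplane (basisPoint b) (Φ.exists_isHalfEdge he).choose

theorem cevianHyperplane_of_isHalfEdge {e : E} {v : N} (he : Φ.IsHalfEdge e v) :
    Φ.cevianHyperplane b e = nodeHyperplane (basisPoint b) v := by
  have hn : ¬ ∃ v w, Φ.IsLink e v w := by
    rintro ⟨x, y, hxy, h⟩
    rw [he] at h
    have hx : x ∈ ({v} : Set N) := h ▸ Set.mem_insert x _
    have hy : y ∈ ({v} : Set N) := h ▸ Set.mem_insert_of_mem x rfl
    exact hxy (hx.trans hy.symm)
  have hv : (Φ.exists_isHalfEdge hn).choose = v :=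
    Set.singleton_injective ((Φ.exists_isHalfEdge hn).choose_spec.symm.trans he)
  rw [cevianHyperplane, dif_neg hn, hv]

theorem cevianHyperplane_of_isLink {e : E} {v w : N} (he : Φ.IsLink e v w) :
    Φ.cevianHyperplane b e =
      apicalHyperplane (basisPoint b) v w (apex b he.1 (Φ.gain e v w)) := by
  have hex : ∃ v w, Φ.IsLink e v w := ⟨v, w, he⟩
  rw [cevianHyperplane, dif_pos hex]
  have key : ∀ x y (hxy : Φ.IsLink e x y),
      apicalHyperplane (basisPoint b) x y (apex b hxy.1 (Φ.gain e x y)) =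
        apicalHyperplane (basisPoint b) v w (apex b he.1 (Φ.gain e v w)) := by
    intro x y hxy
    rcases Set.pair_eq_pair_iff.1 (hxy.2.symm.trans he.2) with ⟨rfl, rfl⟩ | ⟨rfl, rfl⟩
    · rfl
    · have h1 : apex b hxy.1 (Φ.gain e x y) = apex b he.1 (Φ.gain e y x) := by
        rw [Φ.gain_inv e y x he]
        exact apex_swap b he.1 _
      rw [h1, apicalHyperplane, apicalHyperplane, Set.pair_comm]
  exact key _ _ hex.choose_spec.choose_spec

end GainGraph

end Cevian

end

/-! In the coordinates of `b`, a link from v to w with gain g contributes the equation x_w = x_v g,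
and a half edge at v contributes x_v = 0. The solutions of the equations of an edge set `S` form
`flat b S`, and the proof consists of reading graph structure off these systems. Along a path each
coordinate is a nonzero right multiple of the preceding one, so a solution vanishes at all nodes of
the path or at none, and some solution does not vanish. Around a circle a nonvanishing solution
closes up exactly when the gain product is 1 (`prod_gain_eq_one_iff`). Hence a circle is balanced if
and only if its equations have a solution that is nonzero on it (`mem_balanced_iff`), while an
unbalanced figure forces zeros at all its nodes. Scaling and gluing such solutions gives the theta
axiom.

A finite set is a circuit of the arrangement if each of its equations follows from the others and
deleting a suitable element leaves an independent set. For a frame circuit, the first condition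
holds because unbalanced figures create zeros and paths transport them (balanced circles need only a
comparison of two solutions); the second holds because edges that each bring a new node can be added
without losing independence. Conversely, in a circuit of the arrangement every node has degree at
least 2, since otherwise a basis vector would violate exactly one equation. Following edges until
the walk closes up (`exists_lasso`) then yields a frame circuit inside it, which must be all of it,
or an isolated unbalanced circle, whose edges cannot be redundant.

For the converse, an apex off the basis has two nonzero coordinates and can be normalized to b_v + g
b_w, which defines the gain g. The resulting gain graph has the given graph and the given
arrangement, so its frame matroid is G(Ω). Since a circle is a frame circuit only if it is balanced
(`IsFrameCircuit.mem_balanced`), the matroid determines the balanced class. -/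

namespace Cevian

/-! ### Nodes, paths and circles in multigraphs -/

namespace Multigraph

variable {N E : Type*} {Γ : Multigraph N E} {x y z v w : N} {e f : E} {P Q R S T C X : Set E}

theorem mem_nodes : v ∈ Γ.nodes S ↔ ∃ e ∈ S, v ∈ Γ.ends e := by
  simp [nodes]

theorem nodes_mono (h : S ⊆ T) : Γ.nodes S ⊆ Γ.nodes T :=
  Set.biUnion_subset_biUnion_left h

@[simp] theorem nodes_union : Γ.nodes (S ∪ T) = Γ.nodes S ∪ Γ.nodes T :=
  Set.biUnion_union _ _ _

@[simp] theorem nodes_insert : Γ.nodes (insert e S) = Γ.ends e ∪ Γ.nodes S :=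
  Set.biUnion_insert _ _ _

@[simp] theorem nodes_singleton : Γ.nodes {e} = Γ.ends e :=
  Set.biUnion_singleton _ _

@[simp] theorem nodes_empty : Γ.nodes ∅ = ∅ :=
  Set.biUnion_empty _

theorem ends_subset_nodes (h : e ∈ S) : Γ.ends e ⊆ Γ.nodes S :=
  fun _ hv => mem_nodes.2 ⟨e, h, hv⟩

theorem IsLink.symm (h : Γ.IsLink e v w) : Γ.IsLink e w v :=
  ⟨h.1.symm, by rw [h.2, Set.pair_comm]⟩

theorem IsLink.not_isHalfEdge (h : Γ.IsLink e v w) : ¬ Γ.IsHalfEdge e x := by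
  intro hx
  have h1 : v ∈ Γ.ends e := by simp [h.2]
  have h2 : w ∈ Γ.ends e := by simp [h.2]
  rw [hx] at h1 h2
  exact h.1 (h1.trans h2.symm)

theorem IsLink.eq_or_eq (h : Γ.IsLink e v w) (h' : Γ.IsLink e x y) :
    (x = v ∧ y = w) ∨ (x = w ∧ y = v) :=
  Set.pair_eq_pair_iff.1 (h'.2.symm.trans h.2)

/-- An edge at `v` is a half edge at `v` or a link with `v` as one endpoint. -/
theorem IsGraph.isHalfEdge_or_isLink (hΓ : Γ.IsGraph) (hv : v ∈ Γ.ends e) :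
    Γ.IsHalfEdge e v ∨ ∃ w, Γ.IsLink e v w := by
  rcases hΓ e with ⟨u, hu⟩ | ⟨u, w, hu⟩
  · left
    rw [hu] at hv
    rwa [show v = u from hv]
  · right
    have := hv
    rw [hu.2] at this
    rcases this with rfl | h
    · exact ⟨w, hu⟩
    · rw [show v = w from h]
      exact ⟨u, hu.symm⟩

/-! #### Paths -/

theorem IsPath.single (h : Γ.IsLink e x y) : Γ.IsPath x y {e} := by
  refine ⟨0, ![x, y], ![e], ?_, rfl, rfl, ?_, ?_⟩
  · intro i j hij
    have := h.1
    fin_cases i <;> fin_cases j <;> simp_all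
  · intro i
    fin_cases i
    exact h
  · ext; simp

theorem nodes_range {n : ℕ} {u : Fin (n + 2) → N} {c : Fin (n + 1) → E}
    (hc : ∀ i, Γ.IsLink (c i) (u i.castSucc) (u i.succ)) :
    Γ.nodes (Set.range c) = Set.range u := by
  ext v
  rw [mem_nodes]
  constructor
  · rintro ⟨_, ⟨i, rfl⟩, hv⟩
    rw [(hc i).2] at hv
    rcases hv with rfl | hv
    · exact ⟨_, rfl⟩
    · exact ⟨_, hv.symm⟩
  · rintro ⟨i, rfl⟩
    induction i using Fin.cases with
    | zero => exact ⟨c 0, ⟨0, rfl⟩, by simp [(hc 0).2]⟩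
    | succ i => exact ⟨c i, ⟨i, rfl⟩, by simp [(hc i).2]⟩

theorem IsPath.cons (h : Γ.IsLink e x y) (hP : Γ.IsPath y z P) (hx : x ∉ Γ.nodes P) :
    Γ.IsPath x z (insert e P) := by
  obtain ⟨n, u, c, hu, hu0, hul, hc, rfl⟩ := hP
  rw [nodes_range hc] at hx
  refine ⟨n + 1, Fin.cons x u, Fin.cons e c, Fin.cons_injective_iff.2 ⟨hx, hu⟩, rfl, ?_, ?_, ?_⟩
  · rw [← Fin.succ_last, Fin.cons_succ, hul]
  · intro i
    induction i using Fin.cases with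
    | zero => simpa [hu0] using h
    | succ i => simpa [← Fin.succ_castSucc] using hc i
  · rw [Fin.range_cons]

/-- Induction on a path, from its end towards its beginning. -/
theorem IsPath.induct {motive : N → Set E → Prop}
    (single : ∀ e x, Γ.IsLink e x z → motive x {e})
    (cons : ∀ e x y P, Γ.IsLink e x y → Γ.IsPath y z P → x ∉ Γ.nodes P → motive y P →
      motive x (insert e P)) (h : Γ.IsPath x z P) : motive x P := by
  obtain ⟨n, u, c, hu, rfl, rfl, hc, rfl⟩ := h
  induction n with
  | zero =>
    have : Set.range c = {c 0} := by
      ext; simp [Fin.exists_fin_one, eq_comm]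
    rw [this]
    exact single _ _ (hc 0)
  | succ n ih =>
    have hc' : ∀ i, Γ.IsLink (Fin.tail c i) (Fin.tail u i.castSucc) (Fin.tail u i.succ) :=
      fun i => hc i.succ
    have hu' : (Fin.tail u).Injective := hu.comp (Fin.succ_injective _)
    have hr : Set.range c = insert (c 0) (Set.range (Fin.tail c)) := by
      rw [← Fin.range_cons, Fin.cons_self_tail]
    rw [hr]
    refine cons _ _ _ _ (hc 0) ⟨n, Fin.tail u, Fin.tail c, hu', rfl, rfl, hc', rfl⟩ ?_
      (ih (Fin.tail u) (Fin.tail c) hu' single cons hc')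
    rw [nodes_range hc']
    rintro ⟨i, hi⟩
    exact Fin.succ_ne_zero _ (hu hi)

theorem IsPath.exists_isLink (h : Γ.IsPath x y P) (he : e ∈ P) : ∃ v w, Γ.IsLink e v w := by
  obtain ⟨n, u, c, -, -, -, hc, rfl⟩ := h
  obtain ⟨i, rfl⟩ := he
  exact ⟨_, _, hc i⟩

theorem IsPath.ne (h : Γ.IsPath x y P) : x ≠ y := by
  obtain ⟨n, u, c, hu, rfl, rfl, -, -⟩ := h
  intro h
  simpa using hu h

theorem IsPath.left_mem (h : Γ.IsPath x y P) : x ∈ Γ.nodes P := by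
  obtain ⟨n, u, c, hu, rfl, rfl, hc, rfl⟩ := h
  simp [nodes_range hc]

theorem IsPath.right_mem (h : Γ.IsPath x y P) : y ∈ Γ.nodes P := by
  obtain ⟨n, u, c, hu, rfl, rfl, hc, rfl⟩ := h
  simp [nodes_range hc]

theorem IsPath.finite (h : Γ.IsPath x y P) : P.Finite := by
  obtain ⟨n, u, c, hu, rfl, rfl, hc, rfl⟩ := h
  exact Set.finite_range c

theorem IsPath.append (hP : Γ.IsPath x y P) (hQ : Γ.IsPath y z Q)
    (h : Γ.nodes P ∩ Γ.nodes Q ⊆ {y}) : Γ.IsPath x z (P ∪ Q) := by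
  revert h
  refine IsPath.induct (motive := fun x P => Γ.nodes P ∩ Γ.nodes Q ⊆ {y} →
    Γ.IsPath x z (P ∪ Q)) ?_ ?_ hP
  · intro e x he h
    refine IsPath.cons he hQ fun hx => he.1 (h ⟨?_, hx⟩)
    simp [he.2]
  · intro e x w P he hP hx ih h
    rw [Set.insert_union]
    simp only [nodes_insert, he.2] at h
    refine IsPath.cons he (ih fun v hv => h ⟨Or.inr hv.1, hv.2⟩) ?_
    rw [nodes_union]
    rintro (h' | h')
    · exact hx h'
    · have := h ⟨Or.inl (Or.inl rfl), h'⟩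
      rw [show x = y from this] at hx
      exact hx hP.right_mem

theorem IsPath.symm (hP : Γ.IsPath x y P) : Γ.IsPath y x P := by
  refine IsPath.induct (motive := fun x P => Γ.IsPath y x P) ?_ ?_ hP
  · intro e x he
    exact .single he.symm
  · intro e x w P he hP hx ih
    rw [Set.insert_eq, Set.union_comm]
    refine ih.append (.single he.symm) ?_
    rintro v ⟨h1, h2⟩
    rw [nodes_singleton, he.2] at h2
    rcases h2 with rfl | h2
    · exact absurd h1 hx
    · exact h2

/-- A path can be split at an inner node. -/
theorem IsPath.split (hP : Γ.IsPath x y P) (hz : z ∈ Γ.nodes P) (hzx : z ≠ x) (hzy : z ≠ y) :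
    ∃ P₁ P₂, Γ.IsPath x z P₁ ∧ Γ.IsPath z y P₂ ∧ P = P₁ ∪ P₂ ∧
      Γ.nodes P₁ ∩ Γ.nodes P₂ = {z} := by
  revert hz hzx
  refine IsPath.induct (motive := fun x P => z ∈ Γ.nodes P → z ≠ x → ∃ P₁ P₂,
    Γ.IsPath x z P₁ ∧ Γ.IsPath z y P₂ ∧ P = P₁ ∪ P₂ ∧ Γ.nodes P₁ ∩ Γ.nodes P₂ = {z}) ?_ ?_ hP
  · intro e x he hz hzx
    rw [nodes_singleton, he.2] at hz
    rcases hz with h | h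
    · exact absurd h hzx
    · exact absurd h hzy
  · intro e x w P he hP hx ih hz hzx
    by_cases hzw : z = w
    · subst hzw
      refine ⟨{e}, P, .single he, hP, rfl, ?_⟩
      rw [nodes_singleton, he.2]
      ext v
      constructor
      · rintro ⟨rfl | h, h'⟩
        · exact absurd h' hx
        · exact h
      · rintro rfl
        exact ⟨Or.inr rfl, hP.left_mem⟩
    · have hz' : z ∈ Γ.nodes P := by
        rw [nodes_insert, he.2] at hz
        rcases hz with (h | h) | h
        · exact absurd h hzx
        · exact absurd h hzw
        · exact h
      obtain ⟨P₁, P₂, h1, h2, rfl, h3⟩ := ih hz' hzw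
      rw [nodes_union] at hx
      refine ⟨insert e P₁, P₂, .cons he h1 fun h => hx (Or.inl h), h2,
        (Set.insert_union ..).symm, ?_⟩
      rw [nodes_insert, he.2, Set.union_inter_distrib_right, h3]
      ext v
      constructor
      · rintro (⟨rfl | h, h'⟩ | h)
        · exact absurd (Or.inr h') hx
        · rw [show v = w from h] at h' ⊢
          exact h3.subset ⟨h1.left_mem, h'⟩
        · exact h
      · exact Or.inr

/-- Edge sets that meet in at most one node have no link in common. -/
theorem disjoint_of_nodes_inter_subset (hP : ∀ e ∈ P, ∃ v w, Γ.IsLink e v w)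
    (h : Γ.nodes P ∩ Γ.nodes Q ⊆ {x}) : Disjoint P Q := by
  refine Set.disjoint_left.2 fun f hf1 hf2 => ?_
  obtain ⟨a, b, hab⟩ := hP f hf1
  have ha : a ∈ Γ.ends f := by simp [hab.2]
  have hb : b ∈ Γ.ends f := by simp [hab.2]
  have ha' := h ⟨ends_subset_nodes hf1 ha, ends_subset_nodes hf2 ha⟩
  have hb' := h ⟨ends_subset_nodes hf1 hb, ends_subset_nodes hf2 hb⟩
  exact hab.1 (ha'.trans hb'.symm)

/-! #### Circles -/

theorem IsClosedPath.rotate {n : ℕ} {u : Fin (n + 2) → N} {c : Fin (n + 2) → E}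
    (h : Γ.IsClosedPath u c) (k : Fin (n + 2)) :
    Γ.IsClosedPath (fun i => u (i + k)) (fun i => c (i + k)) :=
  ⟨h.1.comp (add_left_injective k), h.2.1.comp (add_left_injective k), fun i => by
    simpa [add_right_comm] using h.2.2 (i + k)⟩

theorem range_rotate {n : ℕ} (c : Fin (n + 2) → E) (k : Fin (n + 2)) :
    Set.range (fun i => c (i + k)) = Set.range c :=
  (Equiv.addRight k).surjective.range_comp c

theorem IsClosedPath.isLink_castSucc {n : ℕ} {u : Fin (n + 2) → N} {c : Fin (n + 2) → E}
    (h : Γ.IsClosedPath u c) (i : Fin (n + 1)) :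
    Γ.IsLink (c i.castSucc) (u i.castSucc) (u i.succ) := by
  simpa using h.2.2 i.castSucc

/-- A closed path consists of its last edge and a path. -/
theorem IsClosedPath.isPath {n : ℕ} {u : Fin (n + 2) → N} {c : Fin (n + 2) → E}
    (h : Γ.IsClosedPath u c) :
    Γ.IsLink (c (Fin.last _)) (u (Fin.last _)) (u 0) ∧
      Γ.IsPath (u 0) (u (Fin.last _)) (Set.range fun i : Fin (n + 1) => c i.castSucc) ∧
      c (Fin.last _) ∉ (Set.range fun i : Fin (n + 1) => c i.castSucc) ∧
      Set.range c = insert (c (Fin.last _)) (Set.range fun i : Fin (n + 1) => c i.castSucc) := by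
  refine ⟨by simpa using h.2.2 (Fin.last _), ⟨n, u, _, h.1, rfl, rfl, h.isLink_castSucc, rfl⟩, ?_, ?_⟩
  · rintro ⟨i, hi⟩
    exact (Fin.castSucc_lt_last i).ne (h.2.1 hi)
  · ext e
    simp [Fin.exists_fin_succ', or_comm, eq_comm]

theorem isCircle_insert (he : Γ.IsLink e y x) (hP : Γ.IsPath x y P) (heP : e ∉ P) :
    Γ.IsCircle (insert e P) := by
  obtain ⟨n, u, c, hu, rfl, rfl, hc, rfl⟩ := hP
  have hcinj : c.Injective := by
    intro i j hij
    have h1 := hc i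
    rw [hij] at h1
    rcases h1.eq_or_eq (hc j) with h | h
    · simpa using (hu h.1).symm
    -- Ends in reversed order would require both j = i + 1 and j + 1 = i.
    · have h2 := Fin.ext_iff.1 (hu h.1)
      have h3 := Fin.ext_iff.1 (hu h.2)
      simp at h2 h3
      omega
  refine ⟨n, u, Fin.snoc c e, ⟨hu, Fin.snoc_injective_iff.2 ⟨hcinj, heP⟩, fun i => ?_⟩, ?_⟩
  · induction i using Fin.lastCases with
    | last => simpa using he
    | cast i => simpa using hc i
  · rw [Fin.range_snoc]

theorem IsCircle.exists_eq_insert_of_mem (h : Γ.IsCircle C) (he : e ∈ C) :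
    ∃ x y P, Γ.IsLink e y x ∧ Γ.IsPath x y P ∧ e ∉ P ∧ C = insert e P := by
  obtain ⟨n, u, c, hc, rfl⟩ := h
  obtain ⟨k, rfl⟩ := he
  -- This shift moves the chosen edge to the last position of the closed path.
  have h1 := hc.rotate (k - Fin.last _)
  obtain ⟨h2, h3, h4, h5⟩ := h1.isPath
  simp only [add_sub_cancel] at h2 h3 h4 h5
  rw [range_rotate] at h5
  exact ⟨_, _, _, h2, h3, h4, h5⟩

theorem IsClosedPath.nodes {n : ℕ} {u : Fin (n + 2) → N} {c : Fin (n + 2) → E}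
    (h : Γ.IsClosedPath u c) : Γ.nodes (Set.range c) = Set.range u := by
  obtain ⟨h2, h3, h4, h5⟩ := h.isPath
  rw [h5, nodes_insert, nodes_range h.isLink_castSucc, h2.2]
  refine Set.union_eq_self_of_subset_left ?_
  rintro v (rfl | hv)
  · exact ⟨_, rfl⟩
  · exact ⟨_, hv.symm⟩

theorem IsCircle.exists_eq_insert_of_mem_nodes (h : Γ.IsCircle C) (hx : x ∈ Γ.nodes C) :
    ∃ e y P, Γ.IsLink e y x ∧ Γ.IsPath x y P ∧ e ∉ P ∧ C = insert e P := by
  obtain ⟨n, u, c, hc, rfl⟩ := h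
  rw [hc.nodes] at hx
  obtain ⟨k, rfl⟩ := hx
  have h1 := hc.rotate k
  obtain ⟨h2, h3, h4, h5⟩ := h1.isPath
  simp only [zero_add] at h2 h3 h4 h5
  rw [range_rotate] at h5
  exact ⟨_, _, _, h2, h3, h4, h5⟩

theorem nodes_insert_of_isPath (he : Γ.IsLink e y x) (hP : Γ.IsPath x y P) :
    Γ.nodes (insert e P) = Γ.nodes P := by
  rw [nodes_insert, he.2]
  refine Set.union_eq_self_of_subset_left ?_
  rintro v (rfl | hv)
  · exact hP.right_mem
  · rw [show v = x from hv]
    exact hP.left_mem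

theorem IsCircle.finite (h : Γ.IsCircle C) : C.Finite := by
  obtain ⟨n, u, c, hc, rfl⟩ := h
  exact Set.finite_range c

theorem IsCircle.nonempty (h : Γ.IsCircle C) : C.Nonempty := by
  obtain ⟨n, u, c, hc, rfl⟩ := h
  exact Set.range_nonempty c

theorem IsCircle.exists_isLink (h : Γ.IsCircle C) (he : e ∈ C) : ∃ v w, Γ.IsLink e v w := by
  obtain ⟨x, y, P, h1, -⟩ := h.exists_eq_insert_of_mem he
  exact ⟨_, _, h1⟩

theorem IsCircle.nodes_nonempty (h : Γ.IsCircle C) : (Γ.nodes C).Nonempty := by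
  obtain ⟨e, he⟩ := h.nonempty
  obtain ⟨v, w, hvw⟩ := h.exists_isLink he
  exact ⟨v, ends_subset_nodes he (by simp [hvw.2])⟩

/-- Two internally disjoint paths with the same endpoints form a circle. -/
theorem IsPath.isCircle_union (hP : Γ.IsPath x y P) (hQ : Γ.IsPath x y Q) (hd : Disjoint P Q)
    (h : Γ.nodes P ∩ Γ.nodes Q = {x, y}) : Γ.IsCircle (P ∪ Q) := by
  revert hd h
  refine IsPath.induct (motive := fun x' Q => x' = x → Disjoint P Q →
    Γ.nodes P ∩ Γ.nodes Q = {x, y} → Γ.IsCircle (P ∪ Q)) ?_ ?_ hQ rfl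
  · rintro e _ he rfl hd -
    rw [Set.union_comm, ← Set.insert_eq]
    exact isCircle_insert he.symm hP (Set.disjoint_singleton_right.1 hd)
  · rintro e _ w Q he hQ' hx - rfl hd h
    rw [Set.union_insert]
    rw [Set.disjoint_insert_right] at hd
    refine isCircle_insert he.symm (hP.append hQ'.symm fun v hv => ?_) ?_
    · have := h.subset ⟨hv.1, by simp [hv.2]⟩
      rcases this with rfl | h'
      · exact absurd hv.2 hx
      · exact h'
    · rintro (h' | h')
      · exact hd.1 h'
      · exact hx (ends_subset_nodes h' (by simp [he.2]))

/-- Two nodes of a circle split it into two paths. -/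
theorem IsCircle.split (h : Γ.IsCircle C) (hx : x ∈ Γ.nodes C) (hy : y ∈ Γ.nodes C)
    (hxy : x ≠ y) : ∃ P Q, Γ.IsPath x y P ∧ Γ.IsPath x y Q ∧ Disjoint P Q ∧
      Γ.nodes P ∩ Γ.nodes Q = {x, y} ∧ C = P ∪ Q := by
  obtain ⟨e, w, P, he, hP, heP, rfl⟩ := h.exists_eq_insert_of_mem_nodes hx
  rw [nodes_insert_of_isPath he hP] at hy
  by_cases hyw : y = w
  · subst hyw
    refine ⟨P, {e}, hP, .single he.symm, Set.disjoint_singleton_right.2 heP, ?_, ?_⟩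
    · rw [nodes_singleton, he.2, Set.pair_comm]
      refine Set.inter_eq_right.2 ?_
      rintro v (rfl | hv)
      · exact hP.left_mem
      · rw [show v = y from hv]
        exact hy
    · rw [Set.union_comm]; rfl
  · obtain ⟨P₁, P₂, h1, h2, rfl, h3⟩ := hP.split hy hxy.symm hyw
    have hx2 : x ∉ Γ.nodes P₂ := fun hx2 => hxy (h3.subset ⟨h1.left_mem, hx2⟩)
    refine ⟨P₁, insert e P₂, h1, .cons he.symm h2.symm hx2, ?_, ?_, ?_⟩
    · exact Set.disjoint_insert_right.2 ⟨fun h => heP (Or.inl h),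
        disjoint_of_nodes_inter_subset (fun f => h1.exists_isLink) h3.subset⟩
    · rw [nodes_insert, he.2, Set.inter_union_distrib_left, h3]
      ext v
      constructor
      · rintro (⟨hv, rfl | hv'⟩ | hv)
        · exact absurd (h3.subset ⟨hv, h2.right_mem⟩) (Ne.symm hyw)
        · exact Or.inl hv'
        · exact Or.inr hv
      · rintro (rfl | hv)
        · exact Or.inl ⟨h1.left_mem, Or.inr rfl⟩
        · exact Or.inr hv
    · rw [Set.union_insert]

end Multigraph

end Cevian

/-! ### Following edges: lassos, and frame circuits in sets of minimum degree 2 -/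

namespace Cevian

namespace Multigraph

variable {N E : Type*} {Γ : Multigraph N E} {x y z v w : N} {e f : E} {P Q R S T C X : Set E}

/-- The possible outcomes of following edges of `T` from the node `x` of `X`, off `X`: the walk
ends in a half edge, returns to `X`, or closes a circle. -/
inductive Lasso (Γ : Multigraph N E) (T : Set E) (X : Set N) (x : N) : Prop
  | halfEdge (f : E) (hf : Γ.IsHalfEdge f x) (hfT : f ∈ T)
  | pathHalfEdge (P : Set E) (z : N) (f : E) (hP : Γ.IsPath x z P) (hPX : Γ.nodes P ∩ X = {x})
      (hPT : P ⊆ T) (hf : Γ.IsHalfEdge f z) (hfT : f ∈ T)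
  | ear (P : Set E) (z : N) (hP : Γ.IsPath x z P) (hPX : Γ.nodes P ∩ X = {x, z}) (hPT : P ⊆ T)
  | circle (C : Set E) (hC : Γ.IsCircle C) (hCX : Γ.nodes C ∩ X = {x}) (hCT : C ⊆ T)
  | pathCircle (P C : Set E) (z : N) (hP : Γ.IsPath x z P) (hPX : Γ.nodes P ∩ X = {x})
      (hPT : P ⊆ T) (hC : Γ.IsCircle C) (hCX : Disjoint (Γ.nodes C) X) (hCT : C ⊆ T)
      (hCP : Γ.nodes C ∩ Γ.nodes P = {z})

/-- Induction on the number of edges of `T` outside `P`. The degree condition at `z` gives an edge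
`f` other than `l`, and `f` is off `P` because `l` is the only edge of `P` at `z`. If `f` is a half
edge, or leads back to `P` or to `X`, one of the outcomes is reached; otherwise `f` prolongs the
path and is its new last edge. -/
theorem lasso_of_isPath (hΓ : Γ.IsGraph) (hT : T.Finite) {X : Set N}
    (hdeg : ∀ v ∉ X, ∀ e ∈ T, v ∈ Γ.ends e → ∃ f ∈ T, f ≠ e ∧ v ∈ Γ.ends f)
    {P : Set E} {z : N} {l : E} (hP : Γ.IsPath x z P) (hPT : P ⊆ T)
    (hPX : Γ.nodes P ∩ X = {x}) (hl : l ∈ P) (hlz : z ∈ Γ.ends l)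
    (hlast : ∀ e ∈ P, z ∈ Γ.ends e → e = l) : Γ.Lasso T X x := by
  induction hn : (T \ P).ncard using Nat.strong_induction_on generalizing P z l with
  | _ n ih =>
  subst hn
  have hxP : x ∈ Γ.nodes P ∧ x ∈ X := by
    have : x ∈ Γ.nodes P ∩ X := hPX ▸ rfl
    exact this
  have hzX : z ∉ X := fun hz => hP.ne (hPX.subset ⟨hP.right_mem, hz⟩).symm
  obtain ⟨f, hfT, hfl, hzf⟩ := hdeg z hzX l (hPT hl) hlz
  have hfP : f ∉ P := fun h => hfl (hlast f h hzf)
  rcases hΓ.isHalfEdge_or_isLink hzf with hf | ⟨z', hf⟩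
  · exact .pathHalfEdge P z f hP hPX hPT hf hfT
  by_cases hz'P : z' ∈ Γ.nodes P
  · by_cases hz'x : z' = x
    · subst hz'x
      refine .circle (insert f P) (isCircle_insert hf hP hfP) ?_ (Set.insert_subset hfT hPT)
      rw [nodes_insert_of_isPath hf hP, hPX]
    · have hz'X : z' ∉ X := fun h => hz'x (hPX.subset ⟨hz'P, h⟩)
      -- The edge returns to an inner node of the path: the part after that node closes up to a
      -- circle, and the part before it joins this circle to `X`.
      obtain ⟨P₁, P₂, h1, h2, rfl, h3⟩ := hP.split hz'P hz'x hf.1.symm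
      have hfP₂ : f ∉ P₂ := fun h => hfP (Or.inr h)
      rw [nodes_union] at hPX
      refine .pathCircle P₁ (insert f P₂) z' h1 ?_ (Set.subset_union_left.trans hPT)
        (isCircle_insert hf h2 hfP₂) ?_
        (Set.insert_subset hfT (Set.subset_union_right.trans hPT)) ?_
      · refine Set.Subset.antisymm (fun v hv => hPX.subset ⟨Or.inl hv.1, hv.2⟩) ?_
        rintro _ rfl
        exact ⟨h1.left_mem, hxP.2⟩
      · rw [nodes_insert_of_isPath hf h2]
        refine Set.disjoint_left.2 fun v hv hvX => ?_
        have hvx : v = x := hPX.subset ⟨Or.inr hv, hvX⟩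
        subst hvx
        exact hz'x (h3.subset ⟨h1.left_mem, hv⟩).symm
      · rw [nodes_insert_of_isPath hf h2, Set.inter_comm, h3]
  · have hf' : Γ.nodes P ∩ Γ.nodes {f} ⊆ {z} := by
      rw [nodes_singleton, hf.2]
      rintro v ⟨hv, rfl | h⟩
      · rfl
      · exact absurd (h ▸ hv) hz'P
    have hP' : Γ.IsPath x z' (P ∪ {f}) := hP.append (.single hf) hf'
    have hPT' : P ∪ {f} ⊆ T := Set.union_subset hPT (Set.singleton_subset_iff.2 hfT)
    have hnodes : Γ.nodes (P ∪ {f}) ∩ X = {x} ∪ ({z'} ∩ X) := by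
      have hzP : {z} ∪ Γ.nodes P = Γ.nodes P :=
        Set.union_eq_self_of_subset_left (Set.singleton_subset_iff.2 hP.right_mem)
      rw [nodes_union, nodes_singleton, hf.2, Set.insert_eq, ← Set.union_assoc,
        Set.union_comm _ {z}, hzP, Set.union_inter_distrib_right, hPX]
    by_cases hz'X : z' ∈ X
    · refine .ear (P ∪ {f}) z' hP' ?_ hPT'
      rw [hnodes, Set.inter_eq_left.2 (Set.singleton_subset_iff.2 hz'X)]
      rfl
    · refine ih _ ?_ hP' hPT' ?_ (Or.inr rfl) (by simp [hf.2]) ?_ rfl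
      · refine Set.ncard_lt_ncard ?_ (hT.subset Set.sdiff_subset)
        refine ⟨Set.sdiff_subset_sdiff_right Set.subset_union_left, fun h => ?_⟩
        exact (h ⟨hfT, hfP⟩).2 (Or.inr rfl)
      · rw [hnodes, Set.singleton_inter_eq_empty.2 hz'X, Set.union_empty]
      · rintro e (he | he) hz'e
        · exact absurd (ends_subset_nodes he hz'e) hz'P
        · exact he

/-- The degree condition is imposed only off `X`, so that it survives the removal of edges whose
nodes lie in `X`. This allows two uses: with `X` a single node, to find a first half edge or circle,
and with `X` the nodes of an unbalanced figure `U` and `T = S \ U`, to complete `U` to a frame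
circuit. -/
theorem exists_lasso (hΓ : Γ.IsGraph) (hT : T.Finite) {X : Set N}
    (hdeg : ∀ v ∉ X, ∀ e ∈ T, v ∈ Γ.ends e → ∃ f ∈ T, f ≠ e ∧ v ∈ Γ.ends f)
    (hx : x ∈ X) (he : e ∈ T) (hxe : x ∈ Γ.ends e) : Γ.Lasso T X x := by
  rcases hΓ.isHalfEdge_or_isLink hxe with hf | ⟨z, hf⟩
  · exact .halfEdge e hf he
  · by_cases hz : z ∈ X
    · refine .ear {e} z (.single hf) ?_ (Set.singleton_subset_iff.2 he)
      rw [nodes_singleton, hf.2]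
      refine Set.inter_eq_left.2 ?_
      rintro v (rfl | h)
      · exact hx
      · exact h ▸ hz
    · refine lasso_of_isPath hΓ hT hdeg (.single hf) (Set.singleton_subset_iff.2 he) ?_ rfl
        (by simp [hf.2]) (fun f hf _ => hf)
      rw [nodes_singleton, hf.2]
      ext v
      constructor
      · rintro ⟨h | h, hX⟩
        · exact h
        · exact absurd (h ▸ hX) hz
      · rintro rfl
        exact ⟨Or.inl rfl, hx⟩

theorem IsPath.pair_subset_nodes (hP : Γ.IsPath x y P) : {x, y} ⊆ Γ.nodes P := by
  rintro v (rfl | rfl)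
  · exact hP.left_mem
  · exact hP.right_mem

/-- A circle together with a path that meets it in the two endpoints of the path is a theta
graph. -/
theorem IsCircle.exists_isTheta (hC : Γ.IsCircle C) (hR : Γ.IsPath x y R)
    (hRC : Γ.nodes R ∩ Γ.nodes C = {x, y}) (hd : Disjoint R C) :
    ∃ P Q, Γ.IsTheta P Q R ∧ C = P ∪ Q := by
  have hx : x ∈ Γ.nodes C := (hRC.symm.subset (Or.inl rfl)).2
  have hy : y ∈ Γ.nodes C := (hRC.symm.subset (Or.inr rfl)).2
  obtain ⟨P, Q, hP, hQ, hPQ, hn, rfl⟩ := hC.split hx hy hR.ne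
  rw [nodes_union] at hRC
  rw [Set.disjoint_union_right] at hd
  refine ⟨P, Q, ⟨x, y, hR.ne, hP, hQ, hR, hPQ, hd.2.symm, hd.1.symm, hn, ?_, ?_⟩, rfl⟩
  · refine Set.Subset.antisymm (fun v hv => hRC.subset ⟨hv.2, Or.inr hv.1⟩) ?_
    exact Set.subset_inter hQ.pair_subset_nodes hR.pair_subset_nodes
  · refine Set.Subset.antisymm (fun v hv => hRC.subset ⟨hv.2, Or.inl hv.1⟩) ?_
    exact Set.subset_inter hP.pair_subset_nodes hR.pair_subset_nodes

end Multigraph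

namespace BiasedGraph

open Multigraph

variable {N E : Type*} {Ω : BiasedGraph N E} {x y z v w : N} {e f : E} {P Q R S T U C : Set E}

theorem IsUnbalancedFigure.nonempty (hU : Ω.IsUnbalancedFigure U) : U.Nonempty := by
  rcases hU with ⟨e, v, -, rfl⟩ | ⟨hC, -⟩
  · exact Set.singleton_nonempty e
  · exact hC.nonempty

theorem IsUnbalancedFigure.ne_of_disjoint (hU : Ω.IsUnbalancedFigure U) (h : Disjoint U T) :
    U ≠ T := by
  rintro rfl
  exact hU.nonempty.ne_empty (disjoint_self.1 h)

/-- A finite set in which every node has degree at least `2` and which contains an unbalanced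
figure contains a frame circuit or an isolated unbalanced circle. -/
theorem exists_isFrameCircuit_or_isolated_of_isUnbalancedFigure (hΩ : Ω.IsGraph) (hS : S.Finite)
    (hdeg : ∀ v, ∀ e ∈ S, v ∈ Ω.ends e → ∃ f ∈ S, f ≠ e ∧ v ∈ Ω.ends f)
    (hU : Ω.IsUnbalancedFigure U) (hUS : U ⊆ S) :
    (∃ T ⊆ S, Ω.IsFrameCircuit T) ∨ ∃ C ⊆ S, Ω.IsCircle C ∧ C ∉ Ω.balanced ∧
      ∀ e ∈ S \ C, Disjoint (Ω.ends e) (Ω.nodes C) := by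
  by_cases hiso : ∀ e ∈ S \ U, Disjoint (Ω.ends e) (Ω.nodes U)
  · rcases hU with ⟨e, v, he, rfl⟩ | ⟨hC, hCb⟩
    -- A half edge cannot be isolated, since its node carries a second edge of `S`.
    · obtain ⟨f, hf, hfe, hvf⟩ := hdeg v e (hUS rfl) (by rw [he]; rfl)
      refine absurd (hiso f ⟨hf, hfe⟩) (Set.not_disjoint_iff.2 ⟨v, hvf, ?_⟩)
      rw [nodes_singleton, he]
      rfl
    · exact Or.inr ⟨U, hUS, hC, hCb, hiso⟩
  left
  push Not at hiso
  obtain ⟨e, he, hne⟩ := hiso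
  obtain ⟨x, hxe, hxU⟩ := Set.not_disjoint_iff.1 hne
  have hdeg' : ∀ v ∉ Ω.nodes U, ∀ e ∈ S \ U, v ∈ Ω.ends e →
      ∃ f ∈ S \ U, f ≠ e ∧ v ∈ Ω.ends f := by
    intro v hv e he hve
    obtain ⟨f, hf, hfe, hvf⟩ := hdeg v e he.1 hve
    exact ⟨f, ⟨hf, fun hfU => hv (ends_subset_nodes hfU hvf)⟩, hfe, hvf⟩
  have hdisj : ∀ {T}, T ⊆ S \ U → Disjoint U T := fun hT =>
    Set.disjoint_left.2 fun e he he' => (hT he').2 he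
  rcases exists_lasso hΩ (hS.subset Set.sdiff_subset) hdeg' hxU he hxe with
    ⟨f, hf, hfT⟩ | ⟨P, z, f, hP, hPX, hPT, hf, hfT⟩ | ⟨P, z, hP, hPX, hPT⟩ | ⟨C, hC, hCX, hCT⟩ |
    ⟨P, C, z, hP, hPX, hPT, hC, hCX, hCT, hCP⟩
  · have hfU := Set.singleton_subset_iff.2 hfT
    refine ⟨U ∪ {f}, Set.union_subset hUS (hfU.trans Set.sdiff_subset), Or.inr (Or.inr (Or.inl
      ⟨U, {f}, hU, Or.inl ⟨f, x, hf, rfl⟩, hU.ne_of_disjoint (hdisj hfU), ⟨x, ?_⟩, rfl⟩))⟩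
    rw [nodes_singleton, hf, Set.inter_eq_right.2 (Set.singleton_subset_iff.2 hxU)]
  · have hzU : z ∉ Ω.nodes U := fun hz => hP.ne (hPX.subset ⟨hP.right_mem, hz⟩).symm
    refine ⟨U ∪ {f} ∪ P, ?_, Or.inr (Or.inr (Or.inr
      ⟨U, {f}, P, x, z, hU, Or.inl ⟨f, z, hf, rfl⟩, ?_, hP, ?_, ?_, rfl⟩))⟩
    · exact Set.union_subset (Set.union_subset hUS (Set.singleton_subset_iff.2 hfT.1))
        (hPT.trans Set.sdiff_subset)
    · rw [nodes_singleton, hf]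
      exact Set.disjoint_singleton_right.2 hzU
    · rw [Set.inter_comm, hPX]
    · rw [nodes_singleton, hf, Set.inter_eq_left.2 (Set.singleton_subset_iff.2 hP.right_mem)]
  -- An ear has two distinct endpoints on `U`, so `U` is a circle and `U ∪ P` a theta graph. Either
  -- one of the two new circles is balanced, or the theta graph contains no balanced circle.
  · rcases hU with ⟨e, v, hev, rfl⟩ | ⟨hC, hCb⟩
    · rw [nodes_singleton, hev] at hPX
      have hx := (hPX.symm.subset (Or.inl rfl)).2
      have hz := (hPX.symm.subset (Or.inr rfl)).2
      exact absurd (hx.trans hz.symm) hP.ne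
    · obtain ⟨P₁, P₂, hθ, rfl⟩ := hC.exists_isTheta hP hPX (hdisj hPT).symm
      obtain ⟨a, b, -, h1, h2, h3, d12, d23, d13, n12, n23, n13⟩ := id hθ
      have hPS := hPT.trans Set.sdiff_subset
      by_cases hb2 : P₂ ∪ P ∈ Ω.balanced
      · exact ⟨_, Set.union_subset (Set.subset_union_right.trans hUS) hPS, Or.inl hb2⟩
      by_cases hb1 : P₁ ∪ P ∈ Ω.balanced
      · exact ⟨_, Set.union_subset (Set.subset_union_left.trans hUS) hPS, Or.inl hb1⟩
      exact ⟨_, Set.union_subset hUS hPS, Or.inr (Or.inl ⟨_, _, _, hθ, hCb, hb2, hb1, rfl⟩)⟩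
  · by_cases hb : C ∈ Ω.balanced
    · exact ⟨C, hCT.trans Set.sdiff_subset, Or.inl hb⟩
    · exact ⟨U ∪ C, Set.union_subset hUS (hCT.trans Set.sdiff_subset), Or.inr (Or.inr (Or.inl
        ⟨U, C, hU, Or.inr ⟨hC, hb⟩, hU.ne_of_disjoint (hdisj hCT),
          ⟨x, by rw [Set.inter_comm, hCX]⟩, rfl⟩))⟩
  · by_cases hb : C ∈ Ω.balanced
    · exact ⟨C, hCT.trans Set.sdiff_subset, Or.inl hb⟩
    · refine ⟨U ∪ C ∪ P, ?_, Or.inr (Or.inr (Or.inr ⟨U, C, P, x, z, hU, Or.inr ⟨hC, hb⟩,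
        hCX.symm, hP, by rw [Set.inter_comm, hPX], hCP, rfl⟩))⟩
      exact Set.union_subset (Set.union_subset hUS (hCT.trans Set.sdiff_subset))
        (hPT.trans Set.sdiff_subset)

/-- A nonempty finite set in which every node has degree at least `2` contains a frame circuit or
an isolated unbalanced circle. -/
theorem exists_isFrameCircuit_or_isolated (hΩ : Ω.IsGraph) (hS : S.Finite) (hne : S.Nonempty)
    (hdeg : ∀ v, ∀ e ∈ S, v ∈ Ω.ends e → ∃ f ∈ S, f ≠ e ∧ v ∈ Ω.ends f) :
    (∃ T ⊆ S, Ω.IsFrameCircuit T) ∨ ∃ C ⊆ S, Ω.IsCircle C ∧ C ∉ Ω.balanced ∧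
      ∀ e ∈ S \ C, Disjoint (Ω.ends e) (Ω.nodes C) := by
  have hhalf : ∀ f ∈ S, ∀ v, Ω.IsHalfEdge f v → ∃ U ⊆ S, Ω.IsUnbalancedFigure U :=
    fun f hf v hv => ⟨{f}, Set.singleton_subset_iff.2 hf, Or.inl ⟨f, v, hv, rfl⟩⟩
  have hcirc : ∀ C ⊆ S, Ω.IsCircle C →
      (∃ U ⊆ S, Ω.IsUnbalancedFigure U) ∨ ∃ T ⊆ S, Ω.IsFrameCircuit T := by
    intro C hCS hC
    by_cases hb : C ∈ Ω.balanced
    · exact Or.inr ⟨C, hCS, Or.inl hb⟩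
    · exact Or.inl ⟨C, hCS, Or.inr ⟨hC, hb⟩⟩
  have key : (∃ U ⊆ S, Ω.IsUnbalancedFigure U) ∨ ∃ T ⊆ S, Ω.IsFrameCircuit T := by
    obtain ⟨e, he⟩ := hne
    obtain ⟨x, hx⟩ : ∃ x, x ∈ Ω.ends e := by
      rcases hΩ e with ⟨v, hv⟩ | ⟨v, w, hv⟩
      · exact ⟨v, by rw [hv]; rfl⟩
      · exact ⟨v, by simp [hv.2]⟩
    rcases exists_lasso hΩ hS (X := {x}) (fun v _ => hdeg v) rfl he hx with
      ⟨f, hf, hfT⟩ | ⟨P, z, f, hP, hPX, hPT, hf, hfT⟩ | ⟨P, z, hP, hPX, hPT⟩ |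
      ⟨C, hC, hCX, hCT⟩ | ⟨P, C, z, hP, hPX, hPT, hC, hCX, hCT, hCP⟩
    · exact Or.inl (hhalf f hfT _ hf)
    · exact Or.inl (hhalf f hfT _ hf)
    -- With `X` a single node, an ear would have equal endpoints.
    · exact absurd (hPX.symm.subset (Or.inr rfl)).2.symm hP.ne
    · exact hcirc C hCT hC
    · exact hcirc C hCT hC
  rcases key with ⟨U, hUS, hU⟩ | h
  · exact exists_isFrameCircuit_or_isolated_of_isUnbalancedFigure hΩ hS hdeg hU hUS
  · exact Or.inl h

end BiasedGraph

end Cevian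

/-! ### Independence and circuits in the matroid of a family of hyperplanes -/

namespace Cevian

section Hyperplanes

variable {F V E : Type*} [DivisionRing F] [AddCommGroup V] [Module F V]
  {𝒜 : Set (Submodule F V)} {h : E → Submodule F V} {S : Set E} {e : E}

theorem hyperplaneMatroid_indep_iff (h𝒜 : ∀ H ∈ 𝒜, IsCoatom H) {I : Finset (Submodule F V)} :
    (hyperplaneMatroid 𝒜).Indep I ↔ (I : Set (Submodule F V)) ⊆ 𝒜 ∧ codim (I.inf id) = I.card := by
  have h : (hyperplaneMatroid 𝒜).Indep I ↔ (I : Set (Submodule F V)) ⊆ 𝒜 ∩ {H | IsCoatom H} ∧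
      codim (I.inf id) = I.card := by
    simp only [hyperplaneMatroid, IndepMatroid.matroid_Indep, IndepMatroid.ofFinset_indep]
  have h' : 𝒜 ∩ {H | IsCoatom H} = 𝒜 := Set.inter_eq_left.2 h𝒜
  rwa [h'] at h

theorem hyperplaneMatroid_ground (h𝒜 : ∀ H ∈ 𝒜, IsCoatom H) : (hyperplaneMatroid 𝒜).E = 𝒜 := by
  rw [hyperplaneMatroid]
  exact Set.inter_eq_left.2 h𝒜

instance : (hyperplaneMatroid 𝒜).Finitary := by
  rw [hyperplaneMatroid]
  exact IndepMatroid.ofFinitaryCardAugment_finitary ..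

theorem codim_biInf_le (hh : ∀ e, IsCoatom (h e)) (hS : S.Finite) :
    codim (⨅ e ∈ S, h e) ≤ S.ncard := by
  induction S, hS using Set.Finite.induction_on with
  | empty => simp [codim_top]
  | @insert e S he hS ih =>
    rw [iInf_insert, Set.ncard_insert_of_notMem he hS]
    push_cast
    exact (codim_inf_le (hh e)).trans (by gcongr)

theorem comap_hyperplaneMatroid_ground (hh : ∀ e, IsCoatom (h e)) :
    ((hyperplaneMatroid (Set.range h)).comap h).E = Set.univ := by
  rw [Matroid.comap_ground_eq, hyperplaneMatroid_ground (by simpa using hh)]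
  exact Set.preimage_range h

/-- The codimension is at most the number of distinct hyperplanes, which is at most the number of
edges. Equality of the outer terms therefore forces `h` to be injective on `S`, so the count by
edges already makes parallel edges dependent. -/
theorem comap_hyperplaneMatroid_indep_iff (hh : ∀ e, IsCoatom (h e)) (hS : S.Finite) :
    ((hyperplaneMatroid (Set.range h)).comap h).Indep S ↔ codim (⨅ e ∈ S, h e) = S.ncard := by
  classical
  have hfin := hS.image h
  have hinf : hfin.toFinset.inf id = ⨅ e ∈ S, h e := by
    rw [Finset.inf_id_eq_sInf, hfin.coe_toFinset, sInf_image]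
  -- The general bound is applied to the family of distinct hyperplanes, indexed by themselves.
  have hle : codim (⨅ e ∈ S, h e) ≤ (h '' S).ncard := by
    have := codim_biInf_le (h := fun H : Set.range h => (H : Submodule F V))
      (S := Set.rangeFactorization h '' S) (by simpa using hh) (hS.image _)
    rw [iInf_image] at this
    refine this.trans ?_
    rw [← Set.ncard_image_of_injective _ Subtype.val_injective, Set.image_image]
    rfl
  rw [Matroid.comap_indep_iff, ← hfin.coe_toFinset,
    hyperplaneMatroid_indep_iff (by simpa using hh), hfin.coe_toFinset, hinf,
    ← Set.ncard_eq_toFinset_card _ hfin]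
  constructor
  · rintro ⟨⟨-, h1⟩, h2⟩
    rw [h1, h2.ncard_image]
  · intro h1
    have h2 : (h '' S).ncard = S.ncard := by
      refine le_antisymm (Set.ncard_image_le hS) ?_
      rw [h1] at hle
      exact_mod_cast hle
    exact ⟨⟨Set.image_subset_range h S, by rw [h2, h1]⟩, Set.injOn_of_ncard_image_eq h2 hS⟩

theorem comap_hyperplaneMatroid_indep_insert_iff (hh : ∀ e, IsCoatom (h e)) (hS : S.Finite)
    (he : e ∉ S) : ((hyperplaneMatroid (Set.range h)).comap h).Indep (insert e S) ↔
      ((hyperplaneMatroid (Set.range h)).comap h).Indep S ∧ ¬ ⨅ f ∈ S, h f ≤ h e := by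
  rw [comap_hyperplaneMatroid_indep_iff hh hS, comap_hyperplaneMatroid_indep_iff hh (hS.insert e),
    Set.ncard_insert_of_notMem he hS, iInf_insert]
  by_cases hle : ⨅ f ∈ S, h f ≤ h e
  · rw [inf_eq_right.2 hle]
    refine iff_of_false (fun h' => ?_) (fun h' => h'.2 hle)
    have := codim_biInf_le hh hS
    rw [h'] at this
    have := Nat.cast_le.1 this
    omega
  · rw [codim_inf_of_not_le (hh e) hle]
    push_cast
    rw [Cardinal.add_one_inj]
    exact (and_iff_left hle).symm

/-- A set is a circuit if every hyperplane of it contains the intersection of the others, and if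
it becomes independent upon deletion of some element. -/
theorem comap_hyperplaneMatroid_isCircuit (hh : ∀ e, IsCoatom (h e)) (hS : S.Finite) (he : e ∈ S)
    (hind : ((hyperplaneMatroid (Set.range h)).comap h).Indep (S \ {e}))
    (hle : ∀ e ∈ S, ⨅ f ∈ S \ {e}, h f ≤ h e) :
    ((hyperplaneMatroid (Set.range h)).comap h).IsCircuit S := by
  -- Deleting any one element does not change the intersection. The sets `S \ {f}` thus have equal
  -- rank and equal size, and if one is independent, all are.
  have hcodim : ∀ f ∈ S, codim (⨅ e ∈ S \ {f}, h e) = codim (⨅ e ∈ S, h e) := by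
    intro f hf
    conv_rhs => rw [← Set.insert_sdiff_self_of_mem hf, iInf_insert, inf_eq_right.2 (hle f hf)]
  have hfin : ∀ f, (S \ {f}).Finite := fun f => hS.subset Set.sdiff_subset
  rw [Matroid.isCircuit_iff_dep_forall_sdiff_singleton_indep]
  refine ⟨⟨fun hi => ?_, ?_⟩, fun f hf => ?_⟩
  · rw [← Set.insert_sdiff_self_of_mem he,
      comap_hyperplaneMatroid_indep_insert_iff hh (hfin e) (by simp)] at hi
    exact hi.2 (hle e he)
  · rw [comap_hyperplaneMatroid_ground hh]
    exact Set.subset_univ _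
  · rw [comap_hyperplaneMatroid_indep_iff hh (hfin e), hcodim e he,
      Set.ncard_sdiff_singleton_of_mem he] at hind
    rw [comap_hyperplaneMatroid_indep_iff hh (hfin f), hcodim f hf, hind,
      Set.ncard_sdiff_singleton_of_mem hf]

theorem biInf_le_of_comap_hyperplaneMatroid_isCircuit (hh : ∀ e, IsCoatom (h e))
    (hS : ((hyperplaneMatroid (Set.range h)).comap h).IsCircuit S) (he : e ∈ S) :
    ⨅ f ∈ S \ {e}, h f ≤ h e := by
  by_contra hle
  refine hS.dep.not_indep ?_
  rw [← Set.insert_sdiff_self_of_mem he, comap_hyperplaneMatroid_indep_insert_iff hh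
    (hS.finite.subset Set.sdiff_subset) (by simp)]
  exact ⟨hS.sdiff_singleton_indep he, hle⟩

end Hyperplanes

/-! ### Equations of apical hyperplanes in coordinates -/

section Coordinates

variable {F V N : Type*} [DivisionRing F] [AddCommGroup V] [Module F V]
  (b : Module.Basis N F V) {v w u : N} {x : V}

theorem apicalHyperplane_comm (P : N → ℙ F V) (v w : N) (p : ℙ F V) :
    apicalHyperplane P v w p = apicalHyperplane P w v p := by
  rw [apicalHyperplane, apicalHyperplane, Set.pair_comm]

theorem iSup_basisPoint_submodule (s : Set N) :
    ⨆ u ∈ s, (basisPoint b u).submodule = Submodule.span F (b '' s) := by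
  simp only [basisPoint, Projectivization.submodule_mk]
  rw [Submodule.span_eq_iSup_of_singleton_spans, iSup_image]

theorem mem_iSup_basisPoint_submodule {s : Set N} :
    x ∈ ⨆ u ∈ sᶜ, (basisPoint b u).submodule ↔ ∀ v ∈ s, b.repr x v = 0 := by
  rw [iSup_basisPoint_submodule, b.mem_span_image]
  refine ⟨fun h v hv => ?_, fun h v hv hvs => ?_⟩
  · by_contra hne
    exact h (Finsupp.mem_support_iff.2 hne) hv
  · exact Finsupp.mem_support_iff.1 hv (h v hvs)

theorem mem_nodeHyperplane : x ∈ nodeHyperplane (basisPoint b) v ↔ b.repr x v = 0 := by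
  rw [nodeHyperplane, mem_iSup_basisPoint_submodule]
  simp

theorem mem_apicalHyperplane_apex (hvw : v ≠ w) (g : Fˣ) :
    x ∈ apicalHyperplane (basisPoint b) v w (apex b hvw g) ↔ b.repr x w = b.repr x v * g := by
  rw [apicalHyperplane, apex, Projectivization.submodule_mk, Submodule.mem_sup]
  constructor
  · rintro ⟨y, hy, z, hz, rfl⟩
    obtain ⟨c, rfl⟩ := Submodule.mem_span_singleton.1 hz
    rw [mem_iSup_basisPoint_submodule] at hy
    simp [hy v (Or.inl rfl), hy w (Or.inr rfl), hvw, hvw.symm]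
  · intro h
    -- Subtracting x_v times the apex vector removes the coordinate at `v`, and by the equation also
    -- the one at `w`.
    refine ⟨x - b.repr x v • (b v + (g : F) • b w), ?_, _, Submodule.smul_mem _ _
      (Submodule.mem_span_singleton_self _), sub_add_cancel _ _⟩
    rw [mem_iSup_basisPoint_submodule]
    rintro u (rfl | rfl)
    · simp [hvw.symm]
    · simp [hvw, h]

theorem isCoatom_nodeHyperplane (v : N) : IsCoatom (nodeHyperplane (basisPoint b) v) := by
  have : nodeHyperplane (basisPoint b) v = LinearMap.ker (b.coord v) := by
    ext x
    rw [mem_nodeHyperplane]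
    rfl
  rw [this]
  exact LinearMap.isCoatom_ker_of_surjective fun c => ⟨c • b v, by simp⟩

theorem isCoatom_apicalHyperplane_apex (hvw : v ≠ w) (g : Fˣ) :
    IsCoatom (apicalHyperplane (basisPoint b) v w (apex b hvw g)) := by
  have : apicalHyperplane (basisPoint b) v w (apex b hvw g) =
      LinearMap.ker (b.coord w - (LinearMap.toSpanSingleton F F (g : F)).comp (b.coord v)) := by
    ext x
    rw [mem_apicalHyperplane_apex]
    simp [sub_eq_zero]
  rw [this]
  exact LinearMap.isCoatom_ker_of_surjective fun c => ⟨c • b w, by simp [hvw.symm]⟩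

/-- The apex vector has coordinates 1 at `v` and `g` at `w`; in the equation of the other hyperplane
these give `g = g'`. Thus an oriented link's gain can be recovered from its hyperplane. -/
theorem apicalHyperplane_apex_inj (hvw : v ≠ w) {g g' : Fˣ}
    (h : apicalHyperplane (basisPoint b) v w (apex b hvw g) =
      apicalHyperplane (basisPoint b) v w (apex b hvw g')) : g = g' := by
  have h1 : b v + (g : F) • b w ∈ apicalHyperplane (basisPoint b) v w (apex b hvw g) := by
    rw [mem_apicalHyperplane_apex]
    simp [hvw, hvw.symm]
  rw [h, mem_apicalHyperplane_apex] at h1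
  simpa [hvw, hvw.symm, Units.ext_iff] using h1

theorem basisPoint_injective : Function.Injective (basisPoint b) := by
  intro v w h
  rw [basisPoint, basisPoint, Projectivization.mk_eq_mk_iff'] at h
  obtain ⟨a, ha⟩ := h
  by_contra hne
  have := congrArg (fun x => b.repr x v) ha
  simp [Ne.symm hne] at this

theorem isApex_apex (hvw : v ≠ w) (g : Fˣ) : IsApex (basisPoint b) v w (apex b hvw g) := by
  refine ⟨hvw, ?_, ?_⟩
  · simp only [apex, basisPoint, Projectivization.submodule_mk]
    rw [Submodule.span_singleton_le_iff_mem]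
    exact Submodule.add_mem_sup (Submodule.mem_span_singleton_self _)
      (Submodule.smul_mem _ _ (Submodule.mem_span_singleton_self _))
  · rintro ⟨u, hu⟩
    rw [apex, basisPoint, Projectivization.mk_eq_mk_iff'] at hu
    obtain ⟨a, ha⟩ := hu
    have h1 := congrArg (fun x => b.repr x v) ha
    have h2 := congrArg (fun x => b.repr x w) ha
    simp [hvw.symm, hvw] at h1 h2
    by_cases huv : u = v
    · subst huv
      simp_all
    · have := g.ne_zero
      have := b.ne_zero u
      by_cases huw : u = w <;> simp_all

/-- A vector on the line with a zero coefficient at `v` or at `w` would represent a basis point, so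
both coefficients c and d are nonzero. Left scaling by c⁻¹ leaves the parameter c⁻¹ d. -/
theorem IsApex.exists_eq_apex {p : ℙ F V} (hp : IsApex (basisPoint b) v w p) :
    ∃ g : Fˣ, p = apex b hp.1 g := by
  obtain ⟨hvw, hle, hnot⟩ := hp
  have hmem := hle (show p.rep ∈ p.submodule by
    rw [Projectivization.submodule_eq]; exact Submodule.mem_span_singleton_self _)
  simp only [basisPoint, Projectivization.submodule_mk] at hmem
  obtain ⟨y, hy, z, hz, hyz⟩ := Submodule.mem_sup.1 hmem
  obtain ⟨c, rfl⟩ := Submodule.mem_span_singleton.1 hy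
  obtain ⟨d, rfl⟩ := Submodule.mem_span_singleton.1 hz
  have hne := p.rep_nonzero
  have hc : c ≠ 0 := by
    rintro rfl
    rw [zero_smul, zero_add] at hyz
    refine hnot ⟨w, ?_⟩
    rw [basisPoint, ← p.mk_rep, eq_comm, Projectivization.mk_eq_mk_iff']
    exact ⟨d, hyz⟩
  have hd : d ≠ 0 := by
    rintro rfl
    rw [zero_smul, add_zero] at hyz
    refine hnot ⟨v, ?_⟩
    rw [basisPoint, ← p.mk_rep, eq_comm, Projectivization.mk_eq_mk_iff']
    exact ⟨c, hyz⟩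
  refine ⟨Units.mk0 (c⁻¹ * d) (mul_ne_zero (inv_ne_zero hc) hd), ?_⟩
  conv_lhs => rw [← p.mk_rep]
  rw [apex, Projectivization.mk_eq_mk_iff']
  refine ⟨c, ?_⟩
  rw [← hyz, smul_add, smul_smul, Units.val_mk0, mul_inv_cancel_left₀ hc]

/-- A basis vector lies in the hyperplanes of all edges that are not incident with its node. -/
theorem basis_mem_nodeHyperplane_iff : b u ∈ nodeHyperplane (basisPoint b) v ↔ u ≠ v := by
  classical
  rw [mem_nodeHyperplane]
  simp [Finsupp.single_apply]

theorem basis_mem_apicalHyperplane_iff (hvw : v ≠ w) (g : Fˣ) :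
    b u ∈ apicalHyperplane (basisPoint b) v w (apex b hvw g) ↔ u ≠ v ∧ u ≠ w := by
  rw [mem_apicalHyperplane_apex]
  by_cases h1 : u = v
  · subst h1
    simp [hvw.symm, g.ne_zero.symm]
  · by_cases h2 : u = w
    · subst h2
      simp [hvw.symm]
    · simp [h1, h2]

theorem nodeHyperplane_injective : Function.Injective (nodeHyperplane (basisPoint b)) := by
  intro v w h
  by_contra hne
  have := (basis_mem_nodeHyperplane_iff b (u := v) (v := w)).2 hne
  rw [← h, basis_mem_nodeHyperplane_iff] at this
  exact this rfl

/-- The basis vectors missing from an apical hyperplane reveal its endpoints, so the existential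
definition of `apicalEnds` cannot mix the endpoints of different presentations of `H`. -/
theorem apicalEnds_eq {H : Submodule F V} (hH : IsApicalHyperplane (basisPoint b) H) :
    apicalEnds (basisPoint b) H = {v | b v ∉ H} := by
  ext u
  constructor
  · rintro (rfl | ⟨w, p, hp, rfl⟩)
    · simp [basis_mem_nodeHyperplane_iff]
    · obtain ⟨g, hg⟩ := hp.exists_eq_apex
      rw [hg]
      simp [basis_mem_apicalHyperplane_iff]
  · intro hu
    rcases hH with ⟨v, rfl⟩ | ⟨v, w, p, hp, rfl⟩
    · rw [Set.mem_ofPred_eq, basis_mem_nodeHyperplane_iff, not_not] at hu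
      exact Or.inl (by rw [hu])
    · obtain ⟨g, hg⟩ := hp.exists_eq_apex
      have hvw := hp.1
      rw [Set.mem_ofPred_eq, hg, basis_mem_apicalHyperplane_iff] at hu
      by_cases h1 : u = v
      · subst h1
        exact Or.inr ⟨w, _, hp, rfl⟩
      · have h2 : u = w := by tauto
        subst h2
        refine Or.inr ⟨v, _, isApex_apex b hvw.symm g⁻¹, ?_⟩
        rw [hg, apex_swap, apicalHyperplane_comm]

end Coordinates

end Cevian

/-! ### The linear system of a gain graph -/

noncomputable section

namespace Cevian

/-- The equation of an edge involves only the coordinates at its ends. Solutions can therefore be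
glued, or cut off to zero, along a set `A` of nodes. -/
theorem exists_repr_piecewise {F V N : Type*} [DivisionRing F] [AddCommGroup V] [Module F V]
    (b : Module.Basis N F V) (A : Set N) (x y : V) :
    ∃ z : V, (∀ v ∈ A, b.repr z v = b.repr x v) ∧ ∀ v ∉ A, b.repr z v = b.repr y v := by
  classical
  refine ⟨b.repr.symm ((b.repr x).filter (· ∈ A) + (b.repr y).filter (· ∉ A)), ?_, ?_⟩
  · intro v hv
    simp [hv]
  · intro v hv
    simp [hv]

namespace GainGraph

open Multigraph

variable {F V : Type*} [DivisionRing F] [AddCommGroup V] [Module F V] {N E : Type*}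
  (Φ : GainGraph N E Fˣ) (b : Module.Basis N F V)

/-- The intersection of the Cevian hyperplanes of the edges in `S`. -/
def flat (S : Set E) : Submodule F V := ⨅ e ∈ S, Φ.cevianHyperplane b e

/-- The matroid of the analytic Cevian arrangement, on the edge set. -/
def cevianMatroid : Matroid E :=
  (hyperplaneMatroid (Set.range (Φ.cevianHyperplane b))).comap (Φ.cevianHyperplane b)

variable {Φ b} {e f : E} {v w x y : N} {z : V} {P Q R S T U C : Set E}

theorem mem_flat : z ∈ Φ.flat b S ↔ ∀ e ∈ S, z ∈ Φ.cevianHyperplane b e := by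
  simp [flat]

theorem flat_anti (h : S ⊆ T) : Φ.flat b T ≤ Φ.flat b S :=
  biInf_mono h

theorem mem_cevianHyperplane_of_isLink (he : Φ.IsLink e v w) :
    z ∈ Φ.cevianHyperplane b e ↔ b.repr z w = b.repr z v * Φ.gain e v w := by
  rw [Φ.cevianHyperplane_of_isLink b he, mem_apicalHyperplane_apex]

theorem mem_cevianHyperplane_of_isHalfEdge (he : Φ.IsHalfEdge e v) :
    z ∈ Φ.cevianHyperplane b e ↔ b.repr z v = 0 := by
  rw [Φ.cevianHyperplane_of_isHalfEdge b he, mem_nodeHyperplane]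

theorem isCoatom_cevianHyperplane (e : E) : IsCoatom (Φ.cevianHyperplane b e) := by
  rcases Φ.isGraph e with ⟨v, hv⟩ | ⟨v, w, hv⟩
  · rw [Φ.cevianHyperplane_of_isHalfEdge b hv]
    exact isCoatom_nodeHyperplane b v
  · rw [Φ.cevianHyperplane_of_isLink b hv]
    exact isCoatom_apicalHyperplane_apex b hv.1 _

theorem isApicalHyperplane_cevianHyperplane (e : E) :
    IsApicalHyperplane (basisPoint b) (Φ.cevianHyperplane b e) := by
  rcases Φ.isGraph e with ⟨v, hv⟩ | ⟨v, w, hv⟩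
  · exact Or.inl ⟨v, Φ.cevianHyperplane_of_isHalfEdge b hv⟩
  · exact Or.inr ⟨v, w, _, isApex_apex b hv.1 _, Φ.cevianHyperplane_of_isLink b hv⟩

theorem basis_mem_cevianHyperplane_iff : b v ∈ Φ.cevianHyperplane b e ↔ v ∉ Φ.ends e := by
  rcases Φ.isGraph e with ⟨u, hu⟩ | ⟨u, w, hu⟩
  · rw [Φ.cevianHyperplane_of_isHalfEdge b hu, basis_mem_nodeHyperplane_iff, hu]
    rfl
  · rw [Φ.cevianHyperplane_of_isLink b hu, basis_mem_apicalHyperplane_iff, hu.2]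
    simp

theorem apicalEnds_cevianHyperplane (e : E) :
    apicalEnds (basisPoint b) (Φ.cevianHyperplane b e) = Φ.ends e := by
  rw [apicalEnds_eq b (isApicalHyperplane_cevianHyperplane e)]
  ext v
  simp [basis_mem_cevianHyperplane_iff]

/-- Membership in a Cevian hyperplane depends only on the coordinates at the ends of the edge. -/
theorem mem_cevianHyperplane_congr {z z' : V}
    (h : ∀ v ∈ Φ.ends e, b.repr z v = b.repr z' v) :
    z ∈ Φ.cevianHyperplane b e ↔ z' ∈ Φ.cevianHyperplane b e := by
  rcases Φ.isGraph e with ⟨u, hu⟩ | ⟨u, w, hu⟩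
  · rw [mem_cevianHyperplane_of_isHalfEdge hu, mem_cevianHyperplane_of_isHalfEdge hu,
      h u (by rw [hu]; rfl)]
  · rw [mem_cevianHyperplane_of_isLink hu, mem_cevianHyperplane_of_isLink hu,
      h u (by simp [hu.2]), h w (by simp [hu.2])]

theorem mem_flat_congr {z z' : V} (h : ∀ v ∈ Φ.nodes S, b.repr z v = b.repr z' v) :
    z ∈ Φ.flat b S ↔ z' ∈ Φ.flat b S := by
  rw [mem_flat, mem_flat]
  exact forall₂_congr fun e he =>
    mem_cevianHyperplane_congr fun v hv => h v (ends_subset_nodes he hv)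

theorem repr_eq_zero_iff_of_isLink (he : Φ.IsLink e v w) (hz : z ∈ Φ.cevianHyperplane b e) :
    b.repr z v = 0 ↔ b.repr z w = 0 := by
  rw [(mem_cevianHyperplane_of_isLink he).1 hz]
  simp

theorem repr_left_eq_zero_iff_of_isPath (hP : Φ.IsPath x y P) (hz : z ∈ Φ.flat b P) :
    b.repr z x = 0 ↔ b.repr z y = 0 := by
  refine IsPath.induct (motive := fun w P => z ∈ Φ.flat b P →
    (b.repr z w = 0 ↔ b.repr z y = 0)) ?_ ?_ hP hz
  · exact fun e x he hz => repr_eq_zero_iff_of_isLink he (mem_flat.1 hz e rfl)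
  · exact fun e x w P he _ _ ih hz =>
      (repr_eq_zero_iff_of_isLink he (mem_flat.1 hz e (Or.inl rfl))).trans
        (ih (flat_anti (Set.subset_insert e P) hz))

theorem repr_eq_zero_iff_of_isPath_right (hP : Φ.IsPath x y P) (hz : z ∈ Φ.flat b P)
    (hv : v ∈ Φ.nodes P) : b.repr z v = 0 ↔ b.repr z y = 0 := by
  by_cases hvx : v = x
  · rw [hvx]
    exact repr_left_eq_zero_iff_of_isPath hP hz
  by_cases hvy : v = y
  · rw [hvy]
  obtain ⟨P₁, P₂, -, h, rfl, -⟩ := hP.split hv hvx hvy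
  exact repr_left_eq_zero_iff_of_isPath h (flat_anti Set.subset_union_right hz)

/-- A vector that satisfies the equations of a path vanishes at all nodes of the path or at
none. -/
theorem repr_eq_zero_iff_of_isPath (hP : Φ.IsPath x y P) (hz : z ∈ Φ.flat b P)
    (hv : v ∈ Φ.nodes P) (hw : w ∈ Φ.nodes P) : b.repr z v = 0 ↔ b.repr z w = 0 :=
  (repr_eq_zero_iff_of_isPath_right hP hz hv).trans
    (repr_eq_zero_iff_of_isPath_right hP hz hw).symm

theorem repr_eq_zero_iff_of_isCircle (hC : Φ.IsCircle C) (hz : z ∈ Φ.flat b C)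
    (hv : v ∈ Φ.nodes C) (hw : w ∈ Φ.nodes C) : b.repr z v = 0 ↔ b.repr z w = 0 := by
  obtain ⟨e, y, P, he, hP, -, rfl⟩ := hC.exists_eq_insert_of_mem_nodes hv
  rw [nodes_insert_of_isPath he hP] at hv hw
  exact repr_eq_zero_iff_of_isPath hP (flat_anti (Set.subset_insert e P) hz) hv hw

/-- The equations of a path have a solution that does not vanish on the path. -/
theorem exists_mem_flat_of_isPath (hP : Φ.IsPath x y P) : ∃ z ∈ Φ.flat b P, b.repr z x ≠ 0 := by
  have step : ∀ {e x w P} {z : V}, Φ.IsLink e x w → x ∉ Φ.nodes P → z ∈ Φ.flat b P →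
      b.repr z w ≠ 0 → ∃ z ∈ Φ.flat b (insert e P), b.repr z x ≠ 0 := by
    intro e x w P z he hx hz hzw
    -- The coordinate at `x` is prescribed by the equation of `e`, read from `w` to `x`; the
    -- equations of `P` do not involve it.
    obtain ⟨z', h1, h2⟩ := exists_repr_piecewise b {x} ((b.repr z w * Φ.gain e w x) • b x) z
    have hx' : b.repr z' x = b.repr z w * Φ.gain e w x := by
      rw [h1 x rfl]
      simp
    refine ⟨z', ?_, ?_⟩
    · rw [flat, iInf_insert]
      refine ⟨?_, ?_⟩
      · rw [SetLike.mem_coe, mem_cevianHyperplane_of_isLink he.symm, hx', h2 w he.1.symm]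
      · exact (mem_flat_congr fun v hv => h2 v fun h => hx (h ▸ hv)).2 hz
    · rw [hx']
      simpa using hzw
  refine IsPath.induct (motive := fun x P => ∃ z ∈ Φ.flat b P, b.repr z x ≠ 0) ?_ ?_ hP
  · intro e x he
    rw [← insert_empty_eq]
    exact step (z := b y) he (by simp) (by simp [mem_flat]) (by simp)
  · rintro e x w P he hP hx ⟨z, hz, hzw⟩
    exact step he hx hz hzw

/-! #### Balanced circles -/

/-- Coordinates are left coefficients and gains multiply them on the right, so the gains accumulate
in the order of the path even when F is not commutative. -/
theorem repr_last {n : ℕ} {u : Fin (n + 1) → N} {c : Fin n → E}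
    (hc : ∀ i, Φ.IsLink (c i) (u i.castSucc) (u i.succ))
    (hz : ∀ i, z ∈ Φ.cevianHyperplane b (c i)) :
    b.repr z (u (Fin.last n)) = b.repr z (u 0) *
      ((List.ofFn fun i => Φ.gain (c i) (u i.castSucc) (u i.succ)).prod : Fˣ) := by
  induction n with
  | zero => simp
  | succ n ih =>
    have := ih (u := fun i => u i.castSucc) (c := fun i => c i.castSucc)
      (fun i => hc i.castSucc) (fun i => hz i.castSucc)
    rw [List.ofFn_succ', List.prod_concat, Units.val_mul, ← mul_assoc]
    rw [← Fin.succ_last, (mem_cevianHyperplane_of_isLink (hc (Fin.last n))).1 (hz _), this]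
    rfl

/-- For a solution along the path without the last edge, the last equation says that the coordinate
at `u 0` is unchanged by right multiplication with the gain product. A nonzero coordinate can be
cancelled. -/
theorem prod_gain_eq_one_iff {n : ℕ} {u : Fin (n + 2) → N} {c : Fin (n + 2) → E}
    (h : Φ.IsClosedPath u c) :
    (List.ofFn fun i => Φ.gain (c i) (u i) (u (i + 1))).prod = 1 ↔
      ∃ z ∈ Φ.flat b (Set.range c), b.repr z (u 0) ≠ 0 := by
  obtain ⟨h1, h2, h3, h4⟩ := h.isPath
  have key : ∀ z ∈ Φ.flat b (Set.range fun i : Fin (n + 1) => c i.castSucc),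
      b.repr z (u (Fin.last _)) * Φ.gain (c (Fin.last _)) (u (Fin.last _)) (u 0) =
      b.repr z (u 0) * ((List.ofFn fun i => Φ.gain (c i) (u i) (u (i + 1))).prod : Fˣ) := by
    intro z hz
    rw [repr_last h.isLink_castSucc fun i => mem_flat.1 hz _ ⟨i, rfl⟩]
    rw [List.ofFn_succ' (f := fun i => Φ.gain (c i) (u i) (u (i + 1))), List.prod_concat,
      Units.val_mul, ← mul_assoc]
    simp
  rw [h4, flat, iInf_insert]
  constructor
  · intro hprod
    obtain ⟨z, hz, hz0⟩ := exists_mem_flat_of_isPath (b := b) h2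
    refine ⟨z, ⟨?_, hz⟩, hz0⟩
    rw [SetLike.mem_coe, mem_cevianHyperplane_of_isLink h1, key z hz, hprod]
    simp
  · rintro ⟨z, ⟨hz1, hz2⟩, hz0⟩
    have := key z hz2
    rw [← (mem_cevianHyperplane_of_isLink h1).1 hz1] at this
    have := mul_left_cancel₀ hz0 ((mul_one _).trans this)
    exact (Units.ext this).symm

/-- This form of balance mentions no closed path, hence depends on no starting node or direction. A
solution that is nonzero at one node of the circle is nonzero at all, so any closed path that traces
`C` serves as a witness. -/
theorem mem_balanced_iff (b : Module.Basis N F V) : C ∈ Φ.biasedGraph.balanced ↔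
    Φ.IsCircle C ∧ ∃ z ∈ Φ.flat b C, ∃ v ∈ Φ.nodes C, b.repr z v ≠ 0 := by
  constructor
  · rintro ⟨n, u, c, h, rfl, hprod⟩
    obtain ⟨z, hz, hz0⟩ := (prod_gain_eq_one_iff (b := b) h).1 hprod
    exact ⟨⟨n, u, c, h, rfl⟩, z, hz, u 0, by rw [h.nodes]; exact ⟨0, rfl⟩, hz0⟩
  · rintro ⟨hC, z, hz, v, hv, hzv⟩
    obtain ⟨n, u, c, h, rfl⟩ := id hC
    refine ⟨n, u, c, h, rfl, (prod_gain_eq_one_iff (b := b) h).2 ⟨z, hz, fun h0 => hzv ?_⟩⟩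
    exact (repr_eq_zero_iff_of_isCircle hC hz hv (by rw [h.nodes]; exact ⟨0, rfl⟩)).2 h0

/-- The biased graph of a gain graph satisfies the axioms of a biased graph. -/
theorem isBiased_biasedGraph (b : Module.Basis N F V) : Φ.biasedGraph.IsBiased where
  isGraph := Φ.isGraph
  isCircle := fun _ hC => ((mem_balanced_iff b).1 hC).1
  linear := by
    rintro P Q R ⟨x, y, hxy, hP, hQ, hR, -, -, hPR, hnPQ, hnQR, hnPR⟩ h1 h2
    change Φ.IsPath x y P at hP
    change Φ.IsPath x y Q at hQ
    change Φ.IsPath x y R at hR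
    change Φ.nodes P ∩ Φ.nodes R = {x, y} at hnPR
    have hC := hP.isCircle_union hR hPR hnPR
    rw [mem_balanced_iff b] at h1 h2 ⊢
    obtain ⟨hC1, z, hz, v, hv, hzv⟩ := h1
    obtain ⟨hC2, t, ht, w, hw, htw⟩ := h2
    have hzx : b.repr z x ≠ 0 := fun h => hzv <| (repr_eq_zero_iff_of_isCircle hC1 hz
      (nodes_mono Set.subset_union_left hP.left_mem) hv).1 h
    have htx : b.repr t x ≠ 0 := fun h => htw <| (repr_eq_zero_iff_of_isCircle hC2 ht
      (nodes_mono Set.subset_union_left hQ.left_mem) hw).1 h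
    -- The multiple of `t` that agrees with `z` at `x`. The difference solves the common path `Q`
    -- and vanishes at `x`, hence also at `y`.
    let s := (b.repr z x * (b.repr t x)⁻¹) • t
    have hsx : b.repr s x = b.repr z x := by
      simp [s, htx]
    have hs : s ∈ Φ.flat b (Q ∪ R) := Submodule.smul_mem _ _ ht
    have hsy : b.repr s y = b.repr z y := by
      have hd : z - s ∈ Φ.flat b Q := Submodule.sub_mem _ (flat_anti Set.subset_union_right hz)
        (flat_anti Set.subset_union_left hs)
      have := (repr_eq_zero_iff_of_isPath hQ hd hQ.left_mem hQ.right_mem).1 (by simp [hsx])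
      rw [map_sub, Finsupp.sub_apply, sub_eq_zero] at this
      exact this.symm
    -- `P` and `R` share only the nodes `x` and `y`, where `z` and `s` agree, so the two solutions
    -- glue.
    obtain ⟨q, hq1, hq2⟩ := exists_repr_piecewise b (Φ.nodes P) z s
    have hqR : ∀ v ∈ Φ.nodes R, b.repr q v = b.repr s v := by
      intro v hv
      by_cases hvP : v ∈ Φ.nodes P
      · rw [hq1 v hvP]
        rcases hnPR.subset ⟨hvP, hv⟩ with rfl | rfl
        · exact hsx.symm
        · exact hsy.symm
      · exact hq2 v hvP
    refine ⟨hC, q, ?_, x, nodes_mono Set.subset_union_left hP.left_mem, ?_⟩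
    · rw [flat, iInf_union]
      exact ⟨(mem_flat_congr hq1).2 (flat_anti Set.subset_union_left hz),
        (mem_flat_congr hqR).2 (flat_anti Set.subset_union_right hs)⟩
    · rwa [hq1 x hP.left_mem]

/-- In a balanced circle, every edge is redundant. -/
theorem flat_le_of_mem_balanced (hC : C ∈ Φ.biasedGraph.balanced) (he : e ∈ C) :
    Φ.flat b (C \ {e}) ≤ Φ.cevianHyperplane b e := by
  obtain ⟨hC, z, hz, v, hv, hzv⟩ := (mem_balanced_iff b).1 hC
  obtain ⟨x, y, P, hl, hP, heP, rfl⟩ := hC.exists_eq_insert_of_mem he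
  rw [Set.insert_sdiff_self_of_notMem heP]
  intro t ht
  rw [nodes_insert_of_isPath hl hP] at hv
  have hzP := flat_anti (Set.subset_insert e P) hz
  have hzx : b.repr z x ≠ 0 := fun h =>
    hzv ((repr_eq_zero_iff_of_isPath hP hzP hP.left_mem hv).1 h)
  -- The multiple of the nonvanishing solution that agrees with `t` at `x`. Then `t - s` vanishes at
  -- both ends of `P`, and the equation of `e` holds trivially for it.
  let s := (b.repr t x * (b.repr z x)⁻¹) • z
  have hs : s ∈ Φ.flat b (insert e P) := Submodule.smul_mem _ _ hz
  have hd : t - s ∈ Φ.flat b P := Submodule.sub_mem _ ht (flat_anti (Set.subset_insert e P) hs)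
  have hdx : b.repr (t - s) x = 0 := by simp [s, hzx]
  have hdy := (repr_eq_zero_iff_of_isPath hP hd hP.left_mem hP.right_mem).1 hdx
  have hde : t - s ∈ Φ.cevianHyperplane b e := by
    rw [mem_cevianHyperplane_of_isLink hl, hdx, hdy, zero_mul]
  simpa using Submodule.add_mem _ hde (mem_flat.1 hs e (Or.inl rfl))

/-- A vector that satisfies the equations of all edges but one of a path and vanishes at the
endpoints satisfies the remaining equation. -/
theorem mem_cevianHyperplane_of_isPath (hP : Φ.IsPath x y P) (he : e ∈ P)
    (hz : z ∈ Φ.flat b (P \ {e})) (hx : b.repr z x = 0) (hy : b.repr z y = 0) :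
    z ∈ Φ.cevianHyperplane b e := by
  revert he hz hx
  refine IsPath.induct (motive := fun x P => e ∈ P → z ∈ Φ.flat b (P \ {e}) → b.repr z x = 0 →
    z ∈ Φ.cevianHyperplane b e) ?_ ?_ hP
  · rintro f x hf rfl hz hx
    rw [mem_cevianHyperplane_of_isLink hf, hx, hy, zero_mul]
  · intro f x w P hf hP hxP ih he hz hx
    have hfP : f ∉ P := fun h => hxP (ends_subset_nodes h (by simp [hf.2]))
    by_cases hef : e = f
    · subst hef
      rw [Set.insert_sdiff_self_of_notMem hfP] at hz
      rw [mem_cevianHyperplane_of_isLink hf, hx, zero_mul]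
      exact (repr_eq_zero_iff_of_isPath hP hz hP.left_mem hP.right_mem).2 hy
    · have heP : e ∈ P := he.resolve_left hef
      have hzf := mem_flat.1 hz f ⟨Or.inl rfl, fun h => hef (Eq.symm h)⟩
      exact ih heP (flat_anti (Set.sdiff_subset_sdiff_left (Set.subset_insert f P)) hz)
        ((repr_eq_zero_iff_of_isLink hf hzf).1 hx)

theorem repr_eq_zero_of_isUnbalancedFigure (hU : Φ.biasedGraph.IsUnbalancedFigure U)
    (hz : z ∈ Φ.flat b U) (hv : v ∈ Φ.nodes U) : b.repr z v = 0 := by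
  rcases hU with ⟨e, w, he, rfl⟩ | ⟨hC, hb⟩
  · have hv' : v ∈ Φ.ends e := by simpa using hv
    rw [show Φ.ends e = {w} from he] at hv'
    obtain rfl : v = w := hv'
    exact (mem_cevianHyperplane_of_isHalfEdge he).1 (mem_flat.1 hz e rfl)
  · by_contra h
    exact hb ((mem_balanced_iff b).2 ⟨hC, z, hz, v, hv, h⟩)

/-- In a circle, the zero spreads along the path that remains without `e` to both ends of `e`, whose
equation becomes 0 = 0. For a half edge, the zero is the equation itself. -/
theorem mem_cevianHyperplane_of_isUnbalancedFigure (hU : Φ.biasedGraph.IsUnbalancedFigure U)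
    (he : e ∈ U) (hz : z ∈ Φ.flat b (U \ {e})) (hv : v ∈ Φ.nodes U) (hzv : b.repr z v = 0) :
    z ∈ Φ.cevianHyperplane b e := by
  rcases hU with ⟨f, w, hf, rfl⟩ | ⟨hC, -⟩
  · obtain rfl : e = f := he
    have hv' : v ∈ Φ.ends e := by simpa using hv
    rw [show Φ.ends e = {w} from hf] at hv'
    obtain rfl : v = w := hv'
    exact (mem_cevianHyperplane_of_isHalfEdge hf).2 hzv
  · obtain ⟨x, y, P, hl, hP, heP, rfl⟩ := hC.exists_eq_insert_of_mem he
    change Φ.IsPath x y P at hP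
    change Φ.IsLink e y x at hl
    rw [Set.insert_sdiff_self_of_notMem heP] at hz
    rw [nodes_insert_of_isPath hl hP] at hv
    rw [mem_cevianHyperplane_of_isLink hl,
      (repr_eq_zero_iff_of_isPath hP hz hv hP.left_mem).1 hzv,
      (repr_eq_zero_iff_of_isPath hP hz hv hP.right_mem).1 hzv, zero_mul]

/-! #### Independence -/

theorem cevianMatroid_indep_empty : (Φ.cevianMatroid b).Indep ∅ :=
  Matroid.empty_indep _

/-- The basis vector at the new node `v` satisfies all equations of `T` but not that of `e`. -/
theorem indep_insert (hT : T.Finite) (h : (Φ.cevianMatroid b).Indep T) (hv : v ∈ Φ.ends e)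
    (hvT : v ∉ Φ.nodes T) : (Φ.cevianMatroid b).Indep (insert e T) := by
  have he : e ∉ T := fun he => hvT (ends_subset_nodes he hv)
  refine (comap_hyperplaneMatroid_indep_insert_iff isCoatom_cevianHyperplane hT he).2 ⟨h, fun hle =>
    basis_mem_cevianHyperplane_iff.1 (hle (?_ : b v ∈ Φ.flat b T)) hv⟩
  exact mem_flat.2 fun f hf =>
    basis_mem_cevianHyperplane_iff.2 fun hvf => hvT (ends_subset_nodes hf hvf)

/-- The path is attached starting from `y`, the only node it may share with `T`. Each edge then
brings a new node, its end farther from `y`. -/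
theorem indep_union_of_isPath (hT : T.Finite) (h : (Φ.cevianMatroid b).Indep T)
    (hP : Φ.IsPath x y P) (hTP : Φ.nodes T ∩ Φ.nodes P ⊆ {y}) :
    (Φ.cevianMatroid b).Indep (T ∪ P) := by
  revert hTP
  refine IsPath.induct (motive := fun x P => Φ.nodes T ∩ Φ.nodes P ⊆ {y} →
    (Φ.cevianMatroid b).Indep (T ∪ P)) ?_ ?_ hP
  · intro e x he hTP
    rw [Set.union_comm, ← Set.insert_eq]
    refine indep_insert hT h (v := x) (by simp [he.2]) fun hx => he.1 (hTP ⟨hx, ?_⟩)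
    simp [he.2]
  · intro e x w P he hP hxP ih hTP
    rw [nodes_insert] at hTP
    rw [Set.union_insert]
    refine indep_insert (hT.union hP.finite) (ih fun v hv => hTP ⟨hv.1, Or.inr hv.2⟩) (v := x)
      (by simp [he.2]) ?_
    rw [nodes_union]
    rintro (hx | hx)
    · have : x = y := hTP ⟨hx, Or.inl (by simp [he.2])⟩
      exact hxP (this ▸ hP.right_mem)
    · exact hxP hx

/-- A half edge is deleted altogether. A circle without one of its edges at `v` is a path ending at
`v`, and so can be attached to `T`. -/
theorem indep_union_sdiff_of_isUnbalancedFigure (hT : T.Finite)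
    (h : (Φ.cevianMatroid b).Indep T) (hU : Φ.biasedGraph.IsUnbalancedFigure U)
    (hv : v ∈ Φ.nodes U) (hTU : Φ.nodes T ∩ Φ.nodes U ⊆ {v}) :
    ∃ e ∈ U, (Φ.cevianMatroid b).Indep (T ∪ U \ {e}) := by
  rcases hU with ⟨f, w, hf, rfl⟩ | ⟨hC, -⟩
  · exact ⟨f, rfl, by simpa using h⟩
  · obtain ⟨e, y, P, hl, hP, heP, rfl⟩ := hC.exists_eq_insert_of_mem_nodes hv
    refine ⟨e, Or.inl rfl, ?_⟩
    rw [nodes_insert_of_isPath (Γ := Φ.toMultigraph) hl hP] at hTU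
    rw [Set.insert_sdiff_self_of_notMem heP]
    exact indep_union_of_isPath hT h hP.symm hTU

/-- A nonvanishing solution of the path `C \ {e}` that also satisfied `e` would make `C` balanced.
-/
theorem exists_mem_flat_of_isCircle (hC : Φ.IsCircle C) (hb : C ∉ Φ.biasedGraph.balanced)
    (he : e ∈ C) : ∃ z ∈ Φ.flat b (C \ {e}), z ∉ Φ.cevianHyperplane b e := by
  obtain ⟨x, y, P, hl, hP, heP, rfl⟩ := id <| hC.exists_eq_insert_of_mem he
  rw [Set.insert_sdiff_self_of_notMem heP]
  obtain ⟨z, hz, hzx⟩ := exists_mem_flat_of_isPath (b := b) hP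
  refine ⟨z, hz, fun hze => hb ((mem_balanced_iff b).2 ⟨hC, z, ?_, x, ?_, hzx⟩)⟩
  · rw [flat, iInf_insert]
    exact ⟨hze, hz⟩
  · rw [nodes_insert_of_isPath hl hP]
    exact hP.left_mem

theorem _root_.Cevian.BiasedGraph.IsUnbalancedFigure.finite {Ω : BiasedGraph N E}
    (hU : Ω.IsUnbalancedFigure U) : U.Finite := by
  rcases hU with ⟨f, w, hf, rfl⟩ | ⟨hC, -⟩
  · exact Set.finite_singleton f
  · exact hC.finite

theorem _root_.Cevian.BiasedGraph.IsUnbalancedFigure.nodes_nonempty {Ω : BiasedGraph N E}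
    (hU : Ω.IsUnbalancedFigure U) : (Ω.nodes U).Nonempty := by
  rcases hU with ⟨f, w, hf, rfl⟩ | ⟨hC, -⟩
  · rw [nodes_singleton, hf]
    exact Set.singleton_nonempty w
  · exact hC.nodes_nonempty

theorem indep_of_isUnbalancedFigure (hU : Φ.biasedGraph.IsUnbalancedFigure U) :
    (Φ.cevianMatroid b).Indep U := by
  rcases id hU with ⟨f, w, hf, rfl⟩ | ⟨hC, hb⟩
  · rw [← insert_empty_eq]
    exact indep_insert Set.finite_empty cevianMatroid_indep_empty
      (v := w) (by rw [show Φ.ends f = {w} from hf]; rfl) (by simp)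
  · obtain ⟨v, hv⟩ := hU.nodes_nonempty
    obtain ⟨e, he, hi⟩ := indep_union_sdiff_of_isUnbalancedFigure (b := b) Set.finite_empty
      cevianMatroid_indep_empty hU hv (by simp)
    rw [Set.empty_union] at hi
    rw [← Set.insert_sdiff_self_of_mem he]
    refine (comap_hyperplaneMatroid_indep_insert_iff isCoatom_cevianHyperplane
      (hU.finite.subset Set.sdiff_subset) (by simp)).2 ⟨hi, fun hle => ?_⟩
    obtain ⟨z, hz, hze⟩ := exists_mem_flat_of_isCircle (b := b) hC hb he
    exact hze (hle hz)

end GainGraph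

end Cevian

end

/-! ### The circuits of the analytic arrangement are the frame circuits -/

noncomputable section

namespace Cevian

namespace GainGraph

open Multigraph

variable {F V : Type*} [DivisionRing F] [AddCommGroup V] [Module F V] {N E : Type*}
  {Φ : GainGraph N E Fˣ} {b : Module.Basis N F V}
  {e f : E} {v w x y : N} {z : V} {P Q R S T U C : Set E}

instance : (Φ.cevianMatroid b).Finitary :=
  inferInstanceAs (Matroid.comap _ _).Finitary

theorem cevianMatroid_ground : (Φ.cevianMatroid b).E = Set.univ :=
  comap_hyperplaneMatroid_ground isCoatom_cevianHyperplane

theorem cevianMatroid_isCircuit (hS : S.Finite)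
    (hind : ∃ e ∈ S, (Φ.cevianMatroid b).Indep (S \ {e}))
    (hle : ∀ e ∈ S, ∀ z ∈ Φ.flat b (S \ {e}), z ∈ Φ.cevianHyperplane b e) :
    (Φ.cevianMatroid b).IsCircuit S := by
  obtain ⟨e, he, hi⟩ := hind
  exact comap_hyperplaneMatroid_isCircuit isCoatom_cevianHyperplane hS he hi hle

theorem isCircuit_of_mem_balanced (hC : C ∈ Φ.biasedGraph.balanced) :
    (Φ.cevianMatroid b).IsCircuit C := by
  have hC' := ((mem_balanced_iff b).1 hC).1
  refine cevianMatroid_isCircuit hC'.finite ?_ fun e he z hz => flat_le_of_mem_balanced hC he hz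
  obtain ⟨e, he⟩ := hC'.nonempty
  obtain ⟨x, y, P, -, hP, heP, rfl⟩ := hC'.exists_eq_insert_of_mem he
  refine ⟨e, he, ?_⟩
  rw [Set.insert_sdiff_self_of_notMem heP, ← Set.empty_union P]
  exact indep_union_of_isPath Set.finite_empty cevianMatroid_indep_empty hP (by simp)

/-- The unbalanced circle `P ∪ Q` is intact and forces zeros at both ends of `R`; from these the
equations of `R` other than that of `e` imply the remaining one. -/
theorem mem_cevianHyperplane_of_isTheta (hP : Φ.IsPath x y P) (hQ : Φ.IsPath x y Q)
    (hR : Φ.IsPath x y R) (hPQ : Disjoint P Q) (hPR : Disjoint P R) (hQR : Disjoint Q R)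
    (hn : Φ.nodes P ∩ Φ.nodes Q = {x, y}) (hb : P ∪ Q ∉ Φ.biasedGraph.balanced) (he : e ∈ R)
    (hz : z ∈ Φ.flat b ((P ∪ Q ∪ R) \ {e})) : z ∈ Φ.cevianHyperplane b e := by
  have hPQe : e ∉ P ∪ Q := by
    rintro (h | h)
    · exact Set.disjoint_left.1 hPR h he
    · exact Set.disjoint_left.1 hQR h he
  have hU : Φ.biasedGraph.IsUnbalancedFigure (P ∪ Q) :=
    Or.inr ⟨hP.isCircle_union hQ hPQ hn, hb⟩
  have hzU : z ∈ Φ.flat b (P ∪ Q) :=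
    flat_anti (Set.subset_sdiff_singleton Set.subset_union_left hPQe) hz
  refine mem_cevianHyperplane_of_isPath hR he
    (flat_anti (Set.sdiff_subset_sdiff_left Set.subset_union_right) hz) ?_ ?_
  · exact repr_eq_zero_of_isUnbalancedFigure hU hzU
      (nodes_mono Set.subset_union_left hP.left_mem)
  · exact repr_eq_zero_of_isUnbalancedFigure hU hzU
      (nodes_mono Set.subset_union_left hP.right_mem)

theorem isCircuit_of_isTheta (hθ : Φ.IsTheta P Q R) (h1 : P ∪ Q ∉ Φ.biasedGraph.balanced)
    (h2 : Q ∪ R ∉ Φ.biasedGraph.balanced) (h3 : P ∪ R ∉ Φ.biasedGraph.balanced) :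
    (Φ.cevianMatroid b).IsCircuit (P ∪ Q ∪ R) := by
  obtain ⟨x, y, hxy, hP, hQ, hR, dPQ, dQR, dPR, nPQ, nQR, nPR⟩ := hθ
  have hU : Φ.biasedGraph.IsUnbalancedFigure (P ∪ Q) :=
    Or.inr ⟨hP.isCircle_union hQ dPQ nPQ, h1⟩
  refine cevianMatroid_isCircuit ((hP.finite.union hQ.finite).union hR.finite) ?_ ?_
  · have hnodes : Φ.nodes (P ∪ Q) ∩ Φ.nodes R ⊆ {x, y} := by
      rw [nodes_union, Set.union_inter_distrib_right, nPR, nQR, Set.union_self]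
    have hdis : Disjoint (P ∪ Q) R := Set.disjoint_union_left.2 ⟨dPR, dQR⟩
    have hi : (Φ.cevianMatroid b).Indep (P ∪ Q) := indep_of_isUnbalancedFigure hU
    have hfin := hP.finite.union hQ.finite
    clear nPR nQR dPR dQR h2 h3
    -- The edge to delete is the first edge of `R`: what is left of `R` is empty or a path that
    -- meets the independent circle `P ∪ Q` only in `y`. The induction principle serves here only as
    -- a case distinction.
    refine IsPath.induct (motive := fun x' R => x' = x → Φ.nodes (P ∪ Q) ∩ Φ.nodes R ⊆ {x, y} →
      Disjoint (P ∪ Q) R → ∃ e ∈ P ∪ Q ∪ R, (Φ.cevianMatroid b).Indep ((P ∪ Q ∪ R) \ {e}))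
      ?_ ?_ hR rfl hnodes hdis
    · rintro e x' - - - hd
      refine ⟨e, Or.inr rfl, ?_⟩
      rw [Set.union_sdiff_right, (Set.disjoint_singleton_right.1 hd |>
        Set.sdiff_singleton_eq_self)]
      exact hi
    · intro e x' w R' he hR' hx' _ hxx' hn hd
      refine ⟨e, Or.inr (Or.inl rfl), ?_⟩
      rw [Set.disjoint_insert_right] at hd
      have heR : e ∉ R' := fun h => hx' (ends_subset_nodes h (by simp [he.2]))
      have : (P ∪ Q ∪ insert e R') \ {e} = P ∪ Q ∪ R' := by
        rw [Set.union_insert, Set.insert_sdiff_self_of_notMem]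
        rintro (h | h)
        · exact hd.1 h
        · exact heR h
      rw [this]
      refine indep_union_of_isPath hfin hi hR' fun v hv => ?_
      rw [nodes_insert] at hn
      rcases hn ⟨hv.1, Or.inr hv.2⟩ with h | h
      · rw [h, ← hxx'] at hv
        exact absurd hv.2 hx'
      · exact h
  · rintro e ((he | he) | he) z hz
    · refine mem_cevianHyperplane_of_isTheta hQ hR hP dQR dPQ.symm dPR.symm nQR h2 he ?_
      rwa [Set.union_comm, ← Set.union_assoc]
    · refine mem_cevianHyperplane_of_isTheta hP hR hQ dPR dPQ dQR.symm nPR h3 he ?_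
      rwa [Set.union_right_comm]
    · exact mem_cevianHyperplane_of_isTheta hP hQ hR dPQ dPR dQR nPQ h1 he hz

/-- Meeting in a single node does not separate two half edges at that node; only there is `U₁ ≠ U₂`
needed. -/
theorem notMem_of_isUnbalancedFigure {U₁ U₂ : Set E} (hU₁ : Φ.biasedGraph.IsUnbalancedFigure U₁)
    (hU₂ : Φ.biasedGraph.IsUnbalancedFigure U₂) (hne : U₁ ≠ U₂)
    (hv : Φ.nodes U₁ ∩ Φ.nodes U₂ ⊆ {v}) (he : e ∈ U₁) : e ∉ U₂ := by
  rcases hU₁ with ⟨f, w, hf, rfl⟩ | ⟨hC, -⟩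
  · obtain rfl : e = f := he
    rcases hU₂ with ⟨f', w', hf', rfl⟩ | ⟨hC', -⟩
    · rintro rfl
      exact hne rfl
    · intro he'
      obtain ⟨a, c, hac⟩ := hC'.exists_isLink he'
      exact hac.not_isHalfEdge hf
  · exact Set.disjoint_left.1
      (disjoint_of_nodes_inter_subset (fun e he => hC.exists_isLink he) hv) he

theorem isCircuit_of_tight {U₁ U₂ : Set E} (hU₁ : Φ.biasedGraph.IsUnbalancedFigure U₁)
    (hU₂ : Φ.biasedGraph.IsUnbalancedFigure U₂) (hne : U₁ ≠ U₂)
    (hv : Φ.nodes U₁ ∩ Φ.nodes U₂ = {v}) : (Φ.cevianMatroid b).IsCircuit (U₁ ∪ U₂) := by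
  have hv12 : v ∈ Φ.nodes U₁ ∩ Φ.nodes U₂ := hv ▸ rfl
  -- By symmetry it suffices to delete an edge of `U₁`: then `U₂` is intact and forces a zero at the
  -- common node.
  have key : ∀ {U₁ U₂ : Set E}, Φ.biasedGraph.IsUnbalancedFigure U₁ →
      Φ.biasedGraph.IsUnbalancedFigure U₂ → U₁ ≠ U₂ → Φ.nodes U₁ ∩ Φ.nodes U₂ = {v} →
      ∀ e ∈ U₁, ∀ z ∈ Φ.flat b ((U₁ ∪ U₂) \ {e}), z ∈ Φ.cevianHyperplane b e := by
    intro U₁ U₂ hU₁ hU₂ hne hv e he z hz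
    have hv12 : v ∈ Φ.nodes U₁ ∩ Φ.nodes U₂ := hv ▸ rfl
    have he2 := notMem_of_isUnbalancedFigure hU₁ hU₂ hne hv.subset he
    refine mem_cevianHyperplane_of_isUnbalancedFigure hU₁ he
      (flat_anti (Set.sdiff_subset_sdiff_left Set.subset_union_left) hz) hv12.1 ?_
    exact repr_eq_zero_of_isUnbalancedFigure hU₂
      (flat_anti (Set.subset_sdiff_singleton Set.subset_union_right he2) hz) hv12.2
  refine cevianMatroid_isCircuit (hU₁.finite.union hU₂.finite) ?_ ?_
  · obtain ⟨e, he, hi⟩ := indep_union_sdiff_of_isUnbalancedFigure (b := b) hU₁.finite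
      (indep_of_isUnbalancedFigure hU₁) hU₂ hv12.2 hv.subset
    refine ⟨e, Or.inr he, ?_⟩
    rwa [Set.union_sdiff_distrib, Set.sdiff_singleton_eq_self
      (notMem_of_isUnbalancedFigure hU₂ hU₁ hne.symm (by rw [Set.inter_comm, hv]) he)]
  · rintro e (he | he) z hz
    · exact key hU₁ hU₂ hne hv e he z hz
    · refine key hU₂ hU₁ hne.symm (by rw [Set.inter_comm, hv]) e he z ?_
      rwa [Set.union_comm]

/-- If the deleted edge is in one figure, the other figure forces a zero at its end of `P`, and `P`
transports it. If it is in `P`, both figures are intact and force zeros at both ends of `P`. -/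
theorem isCircuit_of_loose {U₁ U₂ : Set E} (hU₁ : Φ.biasedGraph.IsUnbalancedFigure U₁)
    (hU₂ : Φ.biasedGraph.IsUnbalancedFigure U₂) (hd : Disjoint (Φ.nodes U₁) (Φ.nodes U₂))
    (hP : Φ.IsPath x y P) (h1 : Φ.nodes U₁ ∩ Φ.nodes P = {x})
    (h2 : Φ.nodes U₂ ∩ Φ.nodes P = {y}) : (Φ.cevianMatroid b).IsCircuit (U₁ ∪ U₂ ∪ P) := by
  have dU : ∀ {U x}, Φ.nodes U ∩ Φ.nodes P = {x} → Disjoint P U := fun h =>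
    disjoint_of_nodes_inter_subset (fun e he => hP.exists_isLink he)
      (by rw [Set.inter_comm]; exact h.subset)
  have d12 : Disjoint U₁ U₂ := by
    refine Set.disjoint_left.2 fun e he1 he2 => ?_
    rcases Φ.isGraph e with ⟨v, hv⟩ | ⟨v, w, hv⟩
    · have : v ∈ Φ.ends e := by rw [hv]; rfl
      exact Set.disjoint_left.1 hd (ends_subset_nodes he1 this) (ends_subset_nodes he2 this)
    · have : v ∈ Φ.ends e := by simp [hv.2]
      exact Set.disjoint_left.1 hd (ends_subset_nodes he1 this) (ends_subset_nodes he2 this)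
  have key : ∀ {U₁ U₂ : Set E} {x y}, Φ.biasedGraph.IsUnbalancedFigure U₁ →
      Φ.biasedGraph.IsUnbalancedFigure U₂ → Disjoint U₁ U₂ → Φ.IsPath x y P →
      Φ.nodes U₁ ∩ Φ.nodes P = {x} → Φ.nodes U₂ ∩ Φ.nodes P = {y} →
      ∀ e ∈ U₁, ∀ z ∈ Φ.flat b ((U₁ ∪ U₂ ∪ P) \ {e}), z ∈ Φ.cevianHyperplane b e := by
    intro U₁ U₂ x y hU₁ hU₂ d12 hP h1 h2 e he z hz
    have hx : x ∈ Φ.nodes U₁ ∩ Φ.nodes P := h1 ▸ rfl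
    have hy : y ∈ Φ.nodes U₂ ∩ Φ.nodes P := h2 ▸ rfl
    have he2 := Set.disjoint_left.1 d12 he
    have heP := Set.disjoint_right.1 (dU h1) he
    refine mem_cevianHyperplane_of_isUnbalancedFigure hU₁ he (flat_anti
      (Set.sdiff_subset_sdiff_left (Set.subset_union_left.trans Set.subset_union_left)) hz) hx.1 ?_
    refine (repr_eq_zero_iff_of_isPath hP (flat_anti
      (Set.subset_sdiff_singleton Set.subset_union_right heP) hz) hx.2 hy.2).2 ?_
    exact repr_eq_zero_of_isUnbalancedFigure hU₂ (flat_anti (Set.subset_sdiff_singleton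
      (Set.subset_union_right.trans Set.subset_union_left) he2) hz) hy.1
  have hx : x ∈ Φ.nodes U₁ ∩ Φ.nodes P := h1 ▸ rfl
  have hy : y ∈ Φ.nodes U₂ ∩ Φ.nodes P := h2 ▸ rfl
  refine cevianMatroid_isCircuit ((hU₁.finite.union hU₂.finite).union hP.finite) ?_ ?_
  · obtain ⟨e, he, hi⟩ := indep_union_sdiff_of_isUnbalancedFigure (b := b)
      (hU₁.finite.union hP.finite) (indep_union_of_isPath hU₁.finite
        (indep_of_isUnbalancedFigure hU₁) hP.symm h1.subset) hU₂ hy.1 (by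
        rw [nodes_union, Set.union_inter_distrib_right, hd.inter_eq, Set.empty_union,
          Set.inter_comm, h2])
    refine ⟨e, Or.inl (Or.inr he), ?_⟩
    rwa [Set.union_right_comm, Set.union_sdiff_distrib, Set.sdiff_singleton_eq_self]
    rintro (h | h)
    · exact Set.disjoint_left.1 d12 h he
    · exact Set.disjoint_left.1 (dU h2) h he
  · rintro e ((he | he) | he) z hz
    · exact key hU₁ hU₂ d12 hP h1 h2 e he z hz
    · refine key hU₂ hU₁ d12.symm hP.symm h2 h1 e he z ?_
      rwa [Set.union_comm U₂]
    · refine mem_cevianHyperplane_of_isPath hP he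
        (flat_anti (Set.sdiff_subset_sdiff_left Set.subset_union_right) hz) ?_ ?_
      · exact repr_eq_zero_of_isUnbalancedFigure hU₁ (flat_anti (Set.subset_sdiff_singleton
          (Set.subset_union_left.trans Set.subset_union_left)
          (Set.disjoint_left.1 (dU h1) he)) hz) hx.1
      · exact repr_eq_zero_of_isUnbalancedFigure hU₂ (flat_anti (Set.subset_sdiff_singleton
          (Set.subset_union_right.trans Set.subset_union_left)
          (Set.disjoint_left.1 (dU h2) he)) hz) hy.1

theorem isCircuit_of_isFrameCircuit (hS : Φ.biasedGraph.IsFrameCircuit S) :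
    (Φ.cevianMatroid b).IsCircuit S := by
  rcases hS with hS | ⟨P, Q, R, hθ, h1, h2, h3, rfl⟩ | ⟨U₁, U₂, hU₁, hU₂, hne, ⟨v, hv⟩, rfl⟩ |
    ⟨U₁, U₂, P, x, y, hU₁, hU₂, hd, hP, h1, h2, rfl⟩
  · exact isCircuit_of_mem_balanced hS
  · exact isCircuit_of_isTheta hθ h1 h2 h3
  · exact isCircuit_of_tight hU₁ hU₂ hne hv
  · exact isCircuit_of_loose hU₁ hU₂ hd hP h1 h2

/-- Redundancy of every equation gives minimum degree 2, so the graph-theoretic alternative applies.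
A frame circuit inside `S` is itself a circuit and hence equals `S`; an isolated unbalanced circle
contradicts redundancy. -/
theorem isFrameCircuit_of_isCircuit (hS : (Φ.cevianMatroid b).IsCircuit S) :
    Φ.biasedGraph.IsFrameCircuit S := by
  have hle : ∀ e ∈ S, Φ.flat b (S \ {e}) ≤ Φ.cevianHyperplane b e := fun e he =>
    biInf_le_of_comap_hyperplaneMatroid_isCircuit isCoatom_cevianHyperplane hS he
  have hdeg : ∀ v, ∀ e ∈ S, v ∈ Φ.ends e → ∃ f ∈ S, f ≠ e ∧ v ∈ Φ.ends f := by
    intro v e he hve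
    -- If `e` were the only edge of `S` at `v`, the basis vector `b v` would satisfy all the other
    -- equations but not that of `e`.
    by_contra! hcon
    refine basis_mem_cevianHyperplane_iff.1 (hle e he (mem_flat.2 fun f hf => ?_ : b v ∈ _)) hve
    exact basis_mem_cevianHyperplane_iff.2 (hcon f hf.1 hf.2)
  rcases BiasedGraph.exists_isFrameCircuit_or_isolated (Ω := Φ.biasedGraph) Φ.isGraph hS.finite
    hS.nonempty hdeg with ⟨T, hTS, hT⟩ | ⟨C, hCS, hC, hCb, hiso⟩
  · rwa [← (isCircuit_of_isFrameCircuit (b := b) hT).eq_of_subset_isCircuit hS hTS]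
  · obtain ⟨e, he⟩ := hC.nonempty
    obtain ⟨z, hz, hze⟩ := exists_mem_flat_of_isCircle (b := b) hC hCb he
    -- Cutting `z` off outside `C` satisfies the edges off `C`, which have no node on `C`, and
    -- leaves the equation of `e` violated.
    obtain ⟨t, ht1, ht2⟩ := exists_repr_piecewise b (Φ.nodes C) z 0
    refine absurd (hle e (hCS he) (?_ : t ∈ _)) fun hte => hze ?_
    · refine mem_flat.2 fun f hf => ?_
      by_cases hfC : f ∈ C
      · rw [mem_cevianHyperplane_congr fun v hv => ht1 v (ends_subset_nodes hfC hv)]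
        exact mem_flat.1 hz f ⟨hfC, hf.2⟩
      · rw [mem_cevianHyperplane_congr fun v hv => ht2 v
          (Set.disjoint_left.1 (hiso f ⟨hf.1, hfC⟩) hv)]
        exact Submodule.zero_mem _
    · rwa [← mem_cevianHyperplane_congr fun v hv => ht1 v (ends_subset_nodes he hv)]

/-- The matroid of the analytic Cevian arrangement is the frame matroid of the gain graph. -/
theorem isFrameMatroid_cevianMatroid :
    Φ.biasedGraph.IsFrameMatroid (Φ.cevianMatroid b) :=
  ⟨cevianMatroid_ground, fun _ => ⟨isFrameCircuit_of_isCircuit, isCircuit_of_isFrameCircuit⟩⟩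

/-- A circle is balanced if and only if its rank is less than its size. -/
theorem mem_balanced_iff_codim_lt (hC : Φ.IsCircle C) :
    C ∈ Φ.biasedGraph.balanced ↔ codim (⨅ e ∈ C, Φ.cevianHyperplane b e) < (C.ncard : Cardinal) := by
  have hlt : codim (⨅ e ∈ C, Φ.cevianHyperplane b e) < (C.ncard : Cardinal) ↔
      ¬ (Φ.cevianMatroid b).Indep C := by
    refine ((codim_biInf_le isCoatom_cevianHyperplane hC.finite).lt_iff_ne).trans (not_congr ?_)
    exact (comap_hyperplaneMatroid_indep_iff isCoatom_cevianHyperplane hC.finite).symm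
  rw [hlt]
  refine ⟨fun h => (isCircuit_of_mem_balanced h).dep.not_indep, fun h => ?_⟩
  by_contra hb
  exact h (indep_of_isUnbalancedFigure (Or.inr ⟨hC, hb⟩))

theorem isPointBasis_basisPoint (b : Module.Basis N F V) : IsPointBasis (basisPoint b) := by
  refine ⟨.mk _ b.ne_zero b.linearIndependent, ?_⟩
  have := iSup_basisPoint_submodule b Set.univ
  simpa [b.span_eq] using this

theorem isCevianRepresentation (Φ : GainGraph N E Fˣ) (b : Module.Basis N F V) :
    IsCevianRepresentation Φ.biasedGraph (basisPoint b) (Φ.cevianHyperplane b) where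
  isPointBasis := isPointBasis_basisPoint b
  isApical := isApicalHyperplane_cevianHyperplane
  ends := apicalEnds_cevianHyperplane
  isFrameMatroid := isFrameMatroid_cevianMatroid

theorem cevianBiasedGraph_eq (Φ : GainGraph N E Fˣ) (b : Module.Basis N F V) :
    cevianBiasedGraph (basisPoint b) (Φ.cevianHyperplane b) = Φ.biasedGraph := by
  have hends : (Multigraph.mk fun e => apicalEnds (basisPoint b) (Φ.cevianHyperplane b e)) =
      Φ.toMultigraph := by
    rw [funext (apicalEnds_cevianHyperplane (Φ := Φ) (b := b))]
  have hbal : {C | Φ.IsCircle C ∧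
      codim (⨅ e ∈ C, Φ.cevianHyperplane b e) < (C.ncard : Cardinal)} = Φ.biasedGraph.balanced := by
    ext C
    constructor
    · rintro ⟨hC, h⟩
      exact (mem_balanced_iff_codim_lt hC).2 h
    · intro h
      have hC := ((mem_balanced_iff b).1 h).1
      exact ⟨hC, (mem_balanced_iff_codim_lt hC).1 h⟩
  calc cevianBiasedGraph (basisPoint b) (Φ.cevianHyperplane b) =
        ⟨⟨fun e => apicalEnds (basisPoint b) (Φ.cevianHyperplane b e)⟩, _⟩ := rfl
    _ = ⟨Φ.toMultigraph, Φ.biasedGraph.balanced⟩ := by rw [hends, hbal]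
    _ = Φ.biasedGraph := rfl

/-- A hyperplane determines the endpoints of its edge and, for a link, the gain. The only
coincidences are therefore half edges at the same node and parallel links of equal gain. -/
theorem cevianHyperplane_injective_iff (Φ : GainGraph N E Fˣ) (b : Module.Basis N F V) :
    Function.Injective (Φ.cevianHyperplane b) ↔ Φ.IsSimple := by
  constructor
  · refine fun h => ⟨fun e f v he hf => h ?_, fun e f v w he hf hg => h ?_⟩
    · rw [Φ.cevianHyperplane_of_isHalfEdge b he, Φ.cevianHyperplane_of_isHalfEdge b hf]
    · rw [Φ.cevianHyperplane_of_isLink b he, Φ.cevianHyperplane_of_isLink b hf, hg]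
  · rintro ⟨h1, h2⟩ e f hef
    have hends : Φ.ends e = Φ.ends f := by
      rw [← apicalEnds_cevianHyperplane (b := b), hef, apicalEnds_cevianHyperplane]
    rcases Φ.isGraph e with ⟨v, hv⟩ | ⟨v, w, hv⟩
    · exact h1 e f v hv (hends.symm.trans hv)
    · have hf : Φ.IsLink f v w := ⟨hv.1, hends.symm.trans hv.2⟩
      refine h2 e f v w hv hf (apicalHyperplane_apex_inj b hv.1 ?_)
      rw [← Φ.cevianHyperplane_of_isLink b hv, ← Φ.cevianHyperplane_of_isLink b hf, hef]

end GainGraph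

end Cevian

end

/-! ### Reindexing and the biased graph of a set of hyperplanes -/

noncomputable section

namespace Cevian

open Multigraph

section Reindex

variable {F V : Type*} [DivisionRing F] [AddCommGroup V] [Module F V] {N N' : Type*}
  (σ : N ≃ N') (P : N' → ℙ F V)

theorem iSup_submodule_comp (s : Set N') :
    ⨆ u ∈ σ ⁻¹' s, ((P ∘ σ) u).submodule = ⨆ u ∈ s, (P u).submodule :=
  σ.surjective.iSup_comp (fun u => ⨆ _ : u ∈ s, (P u).submodule)

theorem nodeHyperplane_comp (v : N) : nodeHyperplane (P ∘ σ) v = nodeHyperplane P (σ v) := by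
  rw [nodeHyperplane, nodeHyperplane, ← iSup_submodule_comp σ]
  congr! 3
  simp

theorem apicalHyperplane_comp (v w : N) (p : ℙ F V) :
    apicalHyperplane (P ∘ σ) v w p = apicalHyperplane P (σ v) (σ w) p := by
  rw [apicalHyperplane, apicalHyperplane, ← iSup_submodule_comp σ]
  congr! 4
  simp

theorem isApex_comp {v w : N} {p : ℙ F V} : IsApex (P ∘ σ) v w p ↔ IsApex P (σ v) (σ w) p := by
  simp [IsApex, σ.surjective.range_comp]

/-- Needed because the nodes of `cevianBiasedGraphOfSet` are the basis points themselves: with σ the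
bijection from `N` onto them, endpoints computed for the indexed basis carry over. -/
theorem apicalEnds_comp (H : Submodule F V) :
    apicalEnds P H = σ '' apicalEnds (P ∘ σ) H := by
  ext v
  obtain ⟨v, rfl⟩ := σ.surjective v
  simp [apicalEnds, nodeHyperplane_comp, apicalHyperplane_comp, isApex_comp, σ.surjective.exists]

end Reindex

/-- Injective maps on nodes and edges that preserve endpoints map circles to circles. -/
theorem Multigraph.IsCircle.image {N E N' E' : Type*} {Γ : Multigraph N E}
    {Γ' : Multigraph N' E'} {f : N → N'} {g : E → E'} (hf : f.Injective) (hg : g.Injective)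
    (hends : ∀ e, Γ'.ends (g e) = f '' Γ.ends e) {C : Set E} (hC : Γ.IsCircle C) :
    Γ'.IsCircle (g '' C) := by
  obtain ⟨n, u, c, ⟨hu, hc, h⟩, rfl⟩ := hC
  refine ⟨n, f ∘ u, g ∘ c, ⟨hf.comp hu, hg.comp hc, fun i => ⟨hf.ne (h i).1, ?_⟩⟩,
    (Set.range_comp g c).symm⟩
  rw [Function.comp_apply, hends, (h i).2, Set.image_pair]
  rfl

namespace GainGraph

variable {F V : Type*} [DivisionRing F] [AddCommGroup V] [Module F V] {N E : Type*}

theorem isIso_cevianBiasedGraphOfSet (Φ : GainGraph N E Fˣ) (b : Module.Basis N F V)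
    (hinj : Function.Injective (Φ.cevianHyperplane b)) :
    Φ.biasedGraph.IsIso
      (cevianBiasedGraphOfSet (Set.range (basisPoint b)) (Set.range (Φ.cevianHyperplane b)))
      (Set.rangeFactorization (basisPoint b)) (Set.rangeFactorization (Φ.cevianHyperplane b)) := by
  have hf : Function.Injective (Set.rangeFactorization (basisPoint b)) :=
    fun v w h => basisPoint_injective b (congrArg Subtype.val h)
  have hg : Function.Injective (Set.rangeFactorization (Φ.cevianHyperplane b)) :=
    fun v w h => hinj (congrArg Subtype.val h)
  have hends : ∀ e, (cevianBiasedGraphOfSet (Set.range (basisPoint b))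
      (Set.range (Φ.cevianHyperplane b))).ends (Set.rangeFactorization (Φ.cevianHyperplane b) e) =
      Set.rangeFactorization (basisPoint b) '' Φ.biasedGraph.ends e := by
    intro e
    refine (apicalEnds_comp (Equiv.ofInjective _ (basisPoint_injective b)) Subtype.val
      (Φ.cevianHyperplane b e)).trans ?_
    exact congrArg _ (apicalEnds_cevianHyperplane e)
  refine ⟨⟨hf, Set.rangeFactorization_surjective⟩, ⟨hg, Set.rangeFactorization_surjective⟩,
    hends, fun C hC => ?_⟩
  rw [mem_balanced_iff_codim_lt (b := b) hC]
  refine (and_iff_right (hC.image hf hg hends)).trans ?_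
  rw [Set.ncard_image_of_injective _ hg, iInf_image]
  rfl

theorem exists_map_eq_hyperplaneMatroid (Φ : GainGraph N E Fˣ) (b : Module.Basis N F V)
    (hinj : Function.Injective (Φ.cevianHyperplane b)) :
    ∃ G : Matroid E, Φ.biasedGraph.IsFrameMatroid G ∧
      ∃ hG : Set.InjOn (Φ.cevianHyperplane b) G.E, G.map (Φ.cevianHyperplane b) hG =
        hyperplaneMatroid (Set.range (Φ.cevianHyperplane b)) := by
  refine ⟨Φ.cevianMatroid b, isFrameMatroid_cevianMatroid, hinj.injOn, Matroid.map_comap ?_ _⟩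
  rw [hyperplaneMatroid_ground]
  rintro _ ⟨e, rfl⟩
  exact isCoatom_cevianHyperplane e

end GainGraph

/-! ### Synthetic representations are analytic -/

theorem IsPointBasis.exists_basis {F V N : Type*} [DivisionRing F] [AddCommGroup V] [Module F V]
    {P : N → ℙ F V} (hP : IsPointBasis P) : ∃ b : Module.Basis N F V, basisPoint b = P := by
  have hspan : ⊤ ≤ Submodule.span F (Set.range (Projectivization.rep ∘ P)) := by
    rw [← hP.2]
    refine iSup_le fun v => ?_
    rw [Projectivization.submodule_eq, Submodule.span_singleton_le_iff_mem]
    exact Submodule.subset_span ⟨v, rfl⟩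
  refine ⟨.mk (Projectivization.independent_iff.1 hP.1) hspan, funext fun v => ?_⟩
  simp [basisPoint]

/-- A path contains no circle. -/
theorem Multigraph.IsPath.not_isCircle {N E : Type*} {Γ : Multigraph N E} {x y : N} {P C : Set E}
    (hP : Γ.IsPath x y P) (hC : Γ.IsCircle C) : ¬ C ⊆ P := by
  -- The first node of a path lies on only one edge of it, whereas every node of a circle also lies
  -- on the path left by deleting an edge. Hence a circle avoids the first edge.
  have hdeg : ∀ {x w e P}, Γ.IsLink e x w → x ∉ Γ.nodes P → C ⊆ insert e P → C ⊆ P := by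
    intro x w e P he hx hCP
    refine (Set.subset_insert_iff_of_notMem fun heC => ?_).1 hCP
    obtain ⟨a, c, Q, hl, hQ, heQ, rfl⟩ := hC.exists_eq_insert_of_mem heC
    have hxQ : x ∈ Γ.nodes Q := by
      rw [← nodes_insert_of_isPath hl hQ]
      exact ends_subset_nodes heC (by simp [he.2])
    have hQP : Q ⊆ P := fun f hf =>
      (hCP (Or.inr hf)).resolve_left fun h => heQ (h ▸ hf)
    exact hx (nodes_mono hQP hxQ)
  refine IsPath.induct (motive := fun _ P => ¬ C ⊆ P) ?_ ?_ hP
  · intro e x he hCe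
    rw [← insert_empty_eq] at hCe
    exact hC.nonempty.ne_empty (Set.subset_empty_iff.1 (hdeg he (by simp) hCe))
  · exact fun e x w P he _ hx ih hCP => ih (hdeg he hx hCP)

/-- Circles form an antichain. -/
theorem Multigraph.IsCircle.eq_of_subset {N E : Type*} {Γ : Multigraph N E} {C D : Set E}
    (hC : Γ.IsCircle C) (hD : Γ.IsCircle D) (h : C ⊆ D) : C = D := by
  refine h.antisymm fun e he => ?_
  by_contra heC
  obtain ⟨x, y, P, -, hP, -, rfl⟩ := hD.exists_eq_insert_of_mem he
  exact hP.not_isCircle hC ((Set.subset_insert_iff_of_notMem heC).1 h)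

namespace BiasedGraph

variable {N E : Type*} {Ω : BiasedGraph N E} {C U : Set E}

theorem IsUnbalancedFigure.eq_of_subset_isCircle (hU : Ω.IsUnbalancedFigure U)
    (hC : Ω.IsCircle C) (h : U ⊆ C) : U = C := by
  rcases hU with ⟨e, v, he, rfl⟩ | ⟨hU, -⟩
  · obtain ⟨a, c, hac⟩ := hC.exists_isLink (h rfl)
    exact absurd he hac.not_isHalfEdge
  · exact hU.eq_of_subset hC h

/-- A circle is a frame circuit only if it is balanced. -/
theorem IsFrameCircuit.mem_balanced (h : Ω.IsFrameCircuit C) (hC : Ω.IsCircle C) :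
    C ∈ Ω.balanced := by
  have hfig : ∀ {U₁ U₂}, Ω.IsUnbalancedFigure U₁ → Ω.IsUnbalancedFigure U₂ → U₁ ≠ U₂ →
      U₁ ⊆ C → U₂ ⊆ C → False := fun h₁ h₂ hne hs₁ hs₂ =>
    hne ((h₁.eq_of_subset_isCircle hC hs₁).trans (h₂.eq_of_subset_isCircle hC hs₂).symm)
  rcases h with h | ⟨P, Q, R, ⟨x, y, hxy, hP, hQ, hR, dPQ, dQR, dPR, nPQ, -, -⟩, -, -, -, rfl⟩ |
    ⟨U₁, U₂, hU₁, hU₂, hne, -, rfl⟩ | ⟨U₁, U₂, P, x, y, hU₁, hU₂, hd, -, -, -, rfl⟩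
  · exact h
  · have heq := (hP.isCircle_union hQ dPQ nPQ).eq_of_subset hC Set.subset_union_left
    have hRs : R ⊆ P ∪ Q := heq ▸ Set.subset_union_right
    obtain ⟨e, he, -⟩ := mem_nodes.1 hR.left_mem
    rcases hRs he with h | h
    · exact absurd he (Set.disjoint_left.1 dPR h)
    · exact absurd he (Set.disjoint_left.1 dQR h)
  · exact (hfig hU₁ hU₂ hne Set.subset_union_left Set.subset_union_right).elim
  · refine (hfig hU₁ hU₂ ?_ (Set.subset_union_left.trans Set.subset_union_left)
      (Set.subset_union_right.trans Set.subset_union_left)).elim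
    rintro rfl
    exact hU₁.nodes_nonempty.ne_empty (disjoint_self.1 hd)

/-- A class of circles is determined by the circuits of the frame matroid. -/
theorem balanced_eq_of_isFrameMatroid {Γ : Multigraph N E} {𝓑 𝓑' : Set (Set E)} {M : Matroid E}
    (h : ∀ C ∈ 𝓑, Γ.IsCircle C) (h' : ∀ C ∈ 𝓑', Γ.IsCircle C)
    (hM : (BiasedGraph.mk Γ 𝓑).IsFrameMatroid M) (hM' : (BiasedGraph.mk Γ 𝓑').IsFrameMatroid M) :
    𝓑 = 𝓑' := by
  have key : ∀ {𝓑 𝓑' : Set (Set E)}, (∀ C ∈ 𝓑, Γ.IsCircle C) →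
      (BiasedGraph.mk Γ 𝓑).IsFrameMatroid M → (BiasedGraph.mk Γ 𝓑').IsFrameMatroid M →
      𝓑 ⊆ 𝓑' := fun h hM hM' C hC =>
    ((hM'.2 C).1 ((hM.2 C).2 (Or.inl hC))).mem_balanced (h C hC)
  exact (key h hM hM').antisymm (key h' hM' hM)

end BiasedGraph

/-- The gains are read off the apices, which reproduces the arrangement. Balance is not compared
circle by circle: both biased graphs have the same underlying graph and the same frame matroid, and
these determine the balanced circles. -/
theorem IsCevianRepresentation.exists_gainGraph {F V N E : Type*} [DivisionRing F]
    [AddCommGroup V] [Module F V] {Ω : BiasedGraph N E} (hΩ : Ω.IsBiased)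
    {b : Module.Basis N F V} {h : E → Submodule F V}
    (hh : IsCevianRepresentation Ω (basisPoint b) h) :
    ∃ Φ : GainGraph N E Fˣ, Φ.biasedGraph = Ω ∧ Φ.cevianHyperplane b = h := by
  classical
  have hends : ∀ e, Ω.ends e = {v | b v ∉ h e} := fun e => by
    rw [← hh.ends e, apicalEnds_eq b (hh.isApical e)]
  have hhalf : ∀ e v, Ω.IsHalfEdge e v → h e = nodeHyperplane (basisPoint b) v := by
    intro e v he
    rcases hh.isApical e with ⟨u, hu⟩ | ⟨u, w, p, hp, hu⟩
    · have : u ∈ Ω.ends e := by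
        rw [hends, hu]
        simp [basis_mem_nodeHyperplane_iff]
      rw [he] at this
      rw [hu, show u = v from this]
    · obtain ⟨g, hg⟩ := hp.exists_eq_apex
      rw [hg] at hu
      have h1 : u ∈ Ω.ends e := by
        rw [hends, hu]
        simp [basis_mem_apicalHyperplane_iff]
      have h2 : w ∈ Ω.ends e := by
        rw [hends, hu]
        simp [basis_mem_apicalHyperplane_iff]
      rw [he] at h1 h2
      exact absurd (h1.trans h2.symm) hp.1
  have hlink : ∀ e v w (he : Ω.IsLink e v w), ∃ g : Fˣ,
      h e = apicalHyperplane (basisPoint b) v w (apex b he.1 g) := by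
    intro e v w he
    rcases hh.isApical e with ⟨u, hu⟩ | ⟨x, y, p, hp, hu⟩
    · have hn : ∀ v, v ∈ Ω.ends e → v = u := by
        intro v hv
        rw [hends, hu] at hv
        simpa [basis_mem_nodeHyperplane_iff] using hv
      exact absurd ((hn v (by simp [he.2])).trans (hn w (by simp [he.2])).symm) he.1
    · obtain ⟨g, hg⟩ := hp.exists_eq_apex
      rw [hg] at hu
      have he' : Ω.IsLink e x y := by
        refine ⟨hp.1, ?_⟩
        rw [hends, hu]
        ext t
        simp [basis_mem_apicalHyperplane_iff]
        tauto
      rcases he.eq_or_eq he' with ⟨rfl, rfl⟩ | ⟨rfl, rfl⟩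
      · exact ⟨g, hu⟩
      · refine ⟨g⁻¹, ?_⟩
        rw [hu, apex_swap b hp.1, apicalHyperplane_comm]
  let gain : E → N → N → Fˣ := fun e v w =>
    if he : Ω.IsLink e v w then (hlink e v w he).choose else 1
  have hgain : ∀ e v w (he : Ω.IsLink e v w),
      h e = apicalHyperplane (basisPoint b) v w (apex b he.1 (gain e v w)) := by
    intro e v w he
    have := (hlink e v w he).choose_spec
    simpa only [gain, dif_pos he] using this
  let Φ : GainGraph N E Fˣ :=
    { toMultigraph := Ω.toMultigraph
      isGraph := hΩ.isGraph
      gain := gain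
      gain_inv := fun e v w he => by
        -- The inverse law is forced: the gains chosen for the two directions describe the same
        -- hyperplane, and a hyperplane determines the gain in a given direction.
        refine apicalHyperplane_apex_inj b he.symm.1 ?_
        rw [← hgain e w v he.symm, hgain e v w he, apex_swap b he.1, apicalHyperplane_comm] }
  have hΦ : Φ.cevianHyperplane b = h := by
    funext e
    rcases hΩ.isGraph e with ⟨v, hv⟩ | ⟨v, w, hv⟩
    · rw [Φ.cevianHyperplane_of_isHalfEdge b hv, hhalf e v hv]
    · rw [Φ.cevianHyperplane_of_isLink b (v := v) (w := w) hv]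
      exact (hgain e v w hv).symm
  refine ⟨Φ, ?_, hΦ⟩
  have hM := (Φ.isCevianRepresentation b).isFrameMatroid
  rw [hΦ] at hM
  have := BiasedGraph.balanced_eq_of_isFrameMatroid (Γ := Ω.toMultigraph)
    (GainGraph.isBiased_biasedGraph (Φ := Φ) b).isCircle hΩ.isCircle hM hh.isFrameMatroid
  calc Φ.biasedGraph = ⟨Ω.toMultigraph, Φ.biasedGraph.balanced⟩ := rfl
    _ = Ω := by rw [this]

end Cevian

end

theorem theoremT {F V N E : Type*} [DivisionRing F] [AddCommGroup V] [Module F V] :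
    -- the analytic arrangement of a gain graph is a synthetic Cevian representation
    (∀ (b : Module.Basis N F V) (Φ : Cevian.GainGraph N E Fˣ),
      Φ.biasedGraph.IsBiased ∧
      Cevian.cevianBiasedGraph (Cevian.basisPoint b) (Φ.cevianHyperplane b) = Φ.biasedGraph ∧
      Cevian.IsCevianRepresentation Φ.biasedGraph (Cevian.basisPoint b) (Φ.cevianHyperplane b) ∧
      Function.Injective (Cevian.nodeHyperplane (Cevian.basisPoint b)) ∧
      (Function.Injective (Φ.cevianHyperplane b) ↔ Φ.IsSimple) ∧
      (Φ.IsSimple →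
        Φ.biasedGraph.IsIso
          (Cevian.cevianBiasedGraphOfSet (Set.range (Cevian.basisPoint b))
            (Set.range (Φ.cevianHyperplane b)))
          (Set.rangeFactorization (Cevian.basisPoint b))
          (Set.rangeFactorization (Φ.cevianHyperplane b)) ∧
        ∃ G : Matroid E, Φ.biasedGraph.IsFrameMatroid G ∧
          ∃ hG : Set.InjOn (Φ.cevianHyperplane b) G.E,
            G.map (Φ.cevianHyperplane b) hG =
              Cevian.hyperplaneMatroid (Set.range (Φ.cevianHyperplane b)))) ∧
    -- every synthetic Cevian representation is analytic
    (∀ (Ω : Cevian.BiasedGraph N E), Ω.IsBiased →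
      ∀ (P : N → Projectivization F V) (h : E → Submodule F V),
        Cevian.IsCevianRepresentation Ω P h →
        (∃ b : Module.Basis N F V, Cevian.basisPoint b = P) ∧
        ∀ b : Module.Basis N F V, Cevian.basisPoint b = P →
          ∃ Φ : Cevian.GainGraph N E Fˣ, Φ.biasedGraph = Ω ∧ Φ.cevianHyperplane b = h) := by
  refine ⟨fun b Φ => ⟨Cevian.GainGraph.isBiased_biasedGraph b, Φ.cevianBiasedGraph_eq b,
    Φ.isCevianRepresentation b, Cevian.nodeHyperplane_injective b,
    Φ.cevianHyperplane_injective_iff b, fun h => ?_⟩, fun Ω hΩ P h hh => ?_⟩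
  · have hinj := (Φ.cevianHyperplane_injective_iff b).2 h
    exact ⟨Φ.isIso_cevianBiasedGraphOfSet b hinj, Φ.exists_map_eq_hyperplaneMatroid b hinj⟩
  · refine ⟨hh.isPointBasis.exists_basis, ?_⟩
    rintro b rfl
    exact hh.exists_gainGraph hΩ
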